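/- Let $(W,S)$ be a Coxeter system with $S$ finite and Coxeter matrix $m$, and let $J\subsetneq S$. Assume $W$ is irreducible, i.e. its Coxeter graph is connected. Let $W^J$ be the set of $w\in W$ none of whose reduced expressions ends in an element of $J$, partially ordered by the Bruhat order; let $e$ be its least element, $\ell(w)$ the height of $w$ in the poset $W^J$, and $\vartriangleleft$ its covering relation. If $w\in W^J$ covers exactly one element of $W^J$, that element is denoted $w'$; such a $w$ is called chainlike if $w'=e$ or (inductively) $w'$ is chainlike. Let $C(W^J)$ be the set of chainlike elements. An expression $s_k\cdots s_0$ ($k\ge 0$) is called simple if $s_0,\dots,s_k\in S$ are distinct, $s_0\notin J$, $s_1,\dots,s_k\in J$, and $m(s_i,s_j)\geq 3\iff |i-j|=1$. A chainlike element $w$ is of * form (I) if $w=s_k\cdots s_0$ for some simple $s_k\cdots s_0$; * form (II) if $w=s_ls_{l+1}\cdots s_{k-1}s_ks_{k-1}\cdots s_0$ for some simple $s_k\cdots s_0$ and $0\le l<k$ with $m(s_k,s_{k-1})\ge 4$ and $m(s_i,s_{i+1})=3$ for $l\le i<k-1$; * form (III) if $w=\underbrace{\cdots s_{k-1}s_ks_{k-1}}_{p\text{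 letters}}s_{k-2}\cdots s_0$ for some simple $s_k\cdots s_0$ with $k\ge1$ and some integer $p$ with $4\le p<m(s_k,s_{k-1})$. For $u,v\in W^J$ let $L(u,v)=\min\{\ell(w): w\in W^J,\ u\le w,\ v\le w\}$, and for $u,v\in C(W^J)$ write $u\sim v$ if $L(u,v)=L(u',v)=L(u,v')$. For $u,v\in C(W^J)$ with $u'=v'$ let $M_1(u,v)=\{u,v\}$, $M_i(u,v)=\{w\in W^J: z\vartriangleleft w\text{ for all }z\in M_{i-1}(u,v)\}$ for $i\ge2$, and $M(u,v)=\min\{i\ge2:|M_i(u,v)|=1\}$, with $M(u,v)=\infty$ if there is no such $i$. Then $\sim$ restricted to the form (I) elements is an equivalence relation, and the following construction, which uses only the poset $W^J$ and the knowledge of which chainlike elements are of form (I), (II) or (III), produces (up to isomorphism) the bw-Coxeter graph of $(W,W_J)$, that is, the graph with vertex set $S$ in which the elements of $J$ are white and those of $S\setminus J$ black, with an edge between $s$ and $t$ iff $m(s,t)\ge 3$, labelled by $m(s,t)\in\{4,5,\dots,\infty\}$ iff $m(s,t)\geq 4$. 1. Draw a node for every equivalence class of $\sim$ restricted to the form (I)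 elements; a node is black if its class contains an element of length $1$, and white otherwise. 2. Connect the nodes of two distinct classes $U,V$ by an edge iff there are $u\in U$, $v\in V$ such that (a) $u=v'$ or $v=u'$, or (b) $u'=v'$ and $M(u,v)\ge3$. Whenever (b) holds with $M(u,v)\ge4$, label the edge with $M(u,v)$. 3. For each form (II) element $u$ such that $u'$ is of form (I), let $q\in\{0,1,\dots,\infty\}$ be the number of form (III) elements greater than $u$, and label the edge between the nodes of the classes containing $u'$ and $u''$ with $q+4$. In particular all labels written on the same edge agree, and no label is written on a pair of nodes not joined by an edge. -/

import Mathlib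

open scoped ENat

noncomputable section

/-! ### Coxeter graphs and black-white Coxeter graphs -/

namespace BWCoxeter

/-- The entry `m(s,t)` of a Coxeter matrix as an element of `ℕ ∪ {∞}`
(Mathlib encodes the value `∞` by `0`). -/
def m {B : Type*} (M : CoxeterMatrix B) (s t : B) : ℕ∞ :=
  if M s t = 0 then ⊤ else (M s t : ℕ∞)

theorem m_comm {B : Type*} (M : CoxeterMatrix B) (s t : B) : m M s t = m M t s := by
  simp only [m, M.symmetric s t]

theorem m_self {B : Type*} (M : CoxeterMatrix B) (s : B) : m M s s = 1 := by
  simp [m]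

/-- The underlying graph of the Coxeter graph: `s` and `t` are joined iff `m(s,t) ≥ 3`. -/
def coxeterGraph {B : Type*} (M : CoxeterMatrix B) : SimpleGraph B where
  Adj s t := 3 ≤ m M s t
  symm := ⟨fun s t h => by rwa [m_comm]⟩
  loopless := ⟨fun s h => by
    rw [m_self] at h
    exact absurd h (by decide)⟩

/-- A graph with each vertex coloured black or white, and with a set of labels written on each
pair of vertices.  An edge `{x, y}` is unlabelled if `label x y = ∅`; an honest labelled graph
has at most one label on each edge and none on non-edges. -/
structure BWGraph (V : Type*) where
  black : Set V
  graph : SimpleGraph V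
  label : V → V → Set ℕ∞

/-- Isomorphism of labelled black-white graphs. -/
def BWGraph.IsIsomorphic {V V' : Type*} (G : BWGraph V) (H : BWGraph V') : Prop :=
  ∃ φ : V ≃ V',
    (∀ x, x ∈ G.black ↔ φ x ∈ H.black) ∧
    (∀ x y, G.graph.Adj x y ↔ H.graph.Adj (φ x) (φ y)) ∧
    (∀ x y, G.label x y = H.label (φ x) (φ y))

/-- The bw-Coxeter graph of `(W, W_J)`: the elements of `J` are white and the other generators are
black, there is an edge when `m(s,t) ≥ 3`, and it is labelled `m(s,t)` when `m(s,t) ≥ 4`. -/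
def bwCoxeterGraph {B : Type*} (M : CoxeterMatrix B) (J : Set B) : BWGraph B where
  black := Jᶜ
  graph := coxeterGraph M
  label s t := {n | n = m M s t ∧ 4 ≤ m M s t}

/-! ### Bruhat order on `W` and the poset `W^J` -/

/-- One step up in Bruhat order: multiplication by a reflection which increases the length. -/
def BruhatStep {B W : Type*} [Group W] {M : CoxeterMatrix B} (cs : CoxeterSystem M W)
    (a b : W) : Prop :=
  ∃ t, cs.IsReflection t ∧ b = a * t ∧ cs.length a < cs.length b

/-- The Bruhat order `u ≤ v` on a Coxeter group. -/
def BruhatLE {B W : Type*} [Group W] {M : CoxeterMatrix B} (cs : CoxeterSystem M W)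
    (u v : W) : Prop :=
  Relation.ReflTransGen (BruhatStep cs) u v

theorem BruhatLE.eq_or_length_lt {B W : Type*} [Group W] {M : CoxeterMatrix B}
    {cs : CoxeterSystem M W} {u v : W} (h : BruhatLE cs u v) :
    u = v ∨ cs.length u < cs.length v := by
  induction h with
  | refl => exact Or.inl rfl
  | tail _ hstep ih =>
    obtain ⟨t, _, _, hlt⟩ := hstep
    rcases ih with rfl | ih
    · exact Or.inr hlt
    · exact Or.inr (ih.trans hlt)

/-- The set `W^J`: the elements none of whose reduced expressions ends in a generator from `J`. -/
def MinRep {B W : Type*} [Group W] {M : CoxeterMatrix B} (cs : CoxeterSystem M W)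
    (J : Set B) : Type _ :=
  {w : W // ∀ (ω : List B) (j : B), cs.IsReduced (ω ++ [j]) → cs.wordProd (ω ++ [j]) = w → j ∉ J}

/-- `W^J` with the restriction of the Bruhat order. -/
instance {B W : Type*} [Group W] {M : CoxeterMatrix B} (cs : CoxeterSystem M W)
    (J : Set B) : PartialOrder (MinRep cs J) where
  le u v := BruhatLE cs u.1 v.1
  le_refl _ := Relation.ReflTransGen.refl
  le_trans _ _ _ h₁ h₂ := Relation.ReflTransGen.trans h₁ h₂
  le_antisymm u v h₁ h₂ := by
    rcases BruhatLE.eq_or_length_lt h₁ with h | h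
    · exact Subtype.ext h
    · rcases BruhatLE.eq_or_length_lt h₂ with h' | h'
      · exact Subtype.ext h'.symm
      · exact absurd (h.trans h') (lt_irrefl _)

/-! ### The three forms of chainlike elements -/

/-- The forms (I), (II), (III). -/
inductive ChainForm
  | I
  | II
  | III

/-- The conditions on `s₀, …, s_k` for `s_k ⋯ s₀` to be a simple expression: the generators are
distinct, only `s₀` is outside `J`, and `m(s_i, s_j) ≥ 3` exactly for consecutive indices. -/
def IsSimpleSeq {B : Type*} (M : CoxeterMatrix B) (J : Set B) (k : ℕ) (s : ℕ → B) : Prop :=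
  (∀ i ≤ k, ∀ j ≤ k, s i = s j → i = j) ∧
  s 0 ∉ J ∧ (∀ i, 1 ≤ i → i ≤ k → s i ∈ J) ∧
  (∀ i ≤ k, ∀ j ≤ k, 3 ≤ m M (s i) (s j) ↔ (i + 1 = j ∨ j + 1 = i))

/-- The word `s_{n-1} s_{n-2} ⋯ s₁ s₀`. -/
def descWord {B : Type*} (s : ℕ → B) (n : ℕ) : List B :=
  ((List.range n).reverse).map s

/-- The word `s_l s_{l+1} ⋯ s_{k-1}`. -/
def ascWord {B : Type*} (s : ℕ → B) (l k : ℕ) : List B :=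
  (List.range' l (k - l)).map s

/-- `w` has the given form:
(I) `w = s_k ⋯ s₀`;
(II) `w = s_l s_{l+1} ⋯ s_{k-1} s_k s_{k-1} ⋯ s₀` with `0 ≤ l < k`, `m(s_k, s_{k-1}) ≥ 4` and
`m(s_i, s_{i+1}) = 3` for `l ≤ i < k - 1`;
(III) `w = (⋯ s_{k-1} s_k s_{k-1}) s_{k-2} ⋯ s₀` where the alternating part in parentheses has `p`
letters, `k ≥ 1` and `4 ≤ p < m(s_k, s_{k-1})`. -/
def HasForm {B W : Type*} [Group W] {M : CoxeterMatrix B} (cs : CoxeterSystem M W) (J : Set B) :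
    ChainForm → MinRep cs J → Prop
  | .I, w => ∃ (k : ℕ) (s : ℕ → B), IsSimpleSeq M J k s ∧
      w.1 = cs.wordProd (descWord s (k + 1))
  | .II, w => ∃ (k : ℕ) (s : ℕ → B), IsSimpleSeq M J k s ∧
      ∃ l < k, 4 ≤ m M (s k) (s (k - 1)) ∧
        (∀ i, l ≤ i → i + 1 < k → m M (s i) (s (i + 1)) = 3) ∧
        w.1 = cs.wordProd (ascWord s l k ++ descWord s (k + 1))
  | .III, w => ∃ (k : ℕ) (s : ℕ → B), IsSimpleSeq M J k s ∧ 1 ≤ k ∧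
      ∃ p : ℕ, 4 ≤ p ∧ (p : ℕ∞) < m M (s k) (s (k - 1)) ∧
        w.1 = cs.wordProd
          (CoxeterSystem.alternatingWord (s k) (s (k - 1)) p ++ descWord s (k - 1))

/-! ### Order-theoretic notions, for an arbitrary poset -/

/-- `x` is the only element covered by `w`; that is, `w` is semi-chainlike and `x = w'`. -/
def IsUniqueLowerCover {P : Type*} [PartialOrder P] (x w : P) : Prop :=
  x ⋖ w ∧ ∀ y, y ⋖ w → y = x

/-- `w` is chainlike: it is semi-chainlike and `w'` is the least element or chainlike. -/
inductive Chainlike {P : Type*} [PartialOrder P] : P → Prop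
  | of_bot {x w : P} : IsUniqueLowerCover x w → IsBot x → Chainlike w
  | of_chainlike {x w : P} : IsUniqueLowerCover x w → Chainlike x → Chainlike w

/-- `L(u,v)`, the least length of a common upper bound of `u` and `v`.  The length of an element is
its height in the poset. -/
def L {P : Type*} [PartialOrder P] (u v : P) : ℕ∞ :=
  ⨅ (w : P) (_ : u ≤ w ∧ v ≤ w), Order.height w

/-- The relation `u ∼ v`, i.e. `L(u,v) = L(u',v) = L(u,v')`. -/
def Sim {P : Type*} [PartialOrder P] (u v : P) : Prop :=
  ∃ u' v', IsUniqueLowerCover u' u ∧ IsUniqueLowerCover v' v ∧ L u v = L u' v ∧ L u v = L u v'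

/-- The sets `M_i(u,v)`: `M₁(u,v) = {u, v}`, and for `i ≥ 2` the set `M_i(u,v)` consists of the
elements covering every element of `M_{i-1}(u,v)`.  (The value at `i = 0` is not used.) -/
def Mset {P : Type*} [PartialOrder P] (u v : P) : ℕ → Set P
  | 0 => {u, v}
  | 1 => {u, v}
  | i + 2 => {w | ∀ z ∈ Mset u v (i + 1), z ⋖ w}

/-- `M(u,v) = min {i ≥ 2 : |M_i(u,v)| = 1}`, and `∞` if there is no such `i`. -/
def Mfun {P : Type*} [PartialOrder P] (u v : P) : ℕ∞ :=
  ⨅ (i : ℕ) (_ : 2 ≤ i ∧ (Mset u v i).encard = 1), (i : ℕ∞)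

theorem Mset_comm {P : Type*} [PartialOrder P] (u v : P) : Mset u v = Mset v u := by
  funext i
  induction i using Nat.strong_induction_on with
  | _ i ih =>
    match i with
    | 0 => exact Set.pair_comm u v
    | 1 => exact Set.pair_comm u v
    | i + 2 => simp only [Mset, ih (i + 1) (by omega)]

theorem Mfun_comm {P : Type*} [PartialOrder P] (u v : P) : Mfun u v = Mfun v u := by
  simp only [Mfun, Mset_comm u v]

/-! ### The construction

The input is a poset `P` and, for each of the three forms, the set `F f` of the chainlike elements
which are declared to have that form. -/

/-- Step 1: the restriction of `∼` to the elements of form (I). -/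
def SimI {P : Type*} [PartialOrder P] (F : ChainForm → Set P) (u v : F .I) : Prop :=
  Sim u.1 v.1

/-- The class of a form (I) element under `∼` restricted to form (I) elements. -/
def simClass {P : Type*} [PartialOrder P] (F : ChainForm → Set P) (u : P) : Set P :=
  {v | v ∈ F .I ∧ Sim u v}

/-- Step 1: the nodes are the classes of form (I) elements. -/
def Node {P : Type*} [PartialOrder P] (F : ChainForm → Set P) : Type _ :=
  {U : Set P // ∃ u ∈ F .I, U = simClass F u}

/-- Step 2: the condition for two classes to be joined by an edge. -/
def Joined {P : Type*} [PartialOrder P] (U V : Set P) : Prop :=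
  ∃ u ∈ U, ∃ v ∈ V,
    (IsUniqueLowerCover u v ∨ IsUniqueLowerCover v u) ∨
    ((∃ x, IsUniqueLowerCover x u ∧ IsUniqueLowerCover x v) ∧ 3 ≤ Mfun u v)

theorem Joined.symm {P : Type*} [PartialOrder P] {U V : Set P} (h : Joined U V) : Joined V U := by
  obtain ⟨u, hu, v, hv, h⟩ := h
  refine ⟨v, hv, u, hu, ?_⟩
  rcases h with h | ⟨⟨x, hxu, hxv⟩, hM⟩
  · exact Or.inl h.symm
  · exact Or.inr ⟨⟨x, hxv, hxu⟩, by rwa [Mfun_comm]⟩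

/-- Step 2, labels: some `u ∈ U` and `v ∈ V` have `u' = v'` and `M(u,v) = n ≥ 4`. -/
def LabelTwo {P : Type*} [PartialOrder P] (U V : Set P) (n : ℕ∞) : Prop :=
  ∃ u ∈ U, ∃ v ∈ V, (∃ x, IsUniqueLowerCover x u ∧ IsUniqueLowerCover x v) ∧
    4 ≤ Mfun u v ∧ n = Mfun u v

/-- Step 3, labels: there is a form (II) element `u` with `u'` of form (I), such that `U` and `V`
are (in some order) the classes containing `u'` and `u''`, and `n = q + 4` where `q` is the number
of form (III) elements greater than `u`. -/
def LabelThree {P : Type*} [PartialOrder P] (F : ChainForm → Set P) (U V : Set P)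
    (n : ℕ∞) : Prop :=
  ∃ u ∈ F .II, ∃ u' ∈ F .I, ∃ u'', IsUniqueLowerCover u' u ∧ IsUniqueLowerCover u'' u' ∧
    ((u' ∈ U ∧ u'' ∈ V) ∨ (u' ∈ V ∧ u'' ∈ U)) ∧
    n = {w | w ∈ F .III ∧ u < w}.encard + 4

/-- The labelled bw-graph produced by the construction; the labels on a pair of nodes are all those
that are written by step 2 or step 3. -/
def construction {P : Type*} [PartialOrder P] (F : ChainForm → Set P) : BWGraph (Node F) where
  black := {U | ∃ u ∈ U.1, Order.height u = 1}
  graph :=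
    { Adj := fun U V => U ≠ V ∧ Joined U.1 V.1
      symm := ⟨fun _ _ h => ⟨h.1.symm, h.2.symm⟩⟩
      loopless := ⟨fun _ h => h.1 rfl⟩ }
  label U V := {n | (U ≠ V ∧ LabelTwo U.1 V.1 n) ∨ LabelThree F U.1 V.1 n}

/-- The actual forms in `W^J`: the set of chainlike elements of `W^J` with the given form. -/
def chainForms {B W : Type*} [Group W] {M : CoxeterMatrix B} (cs : CoxeterSystem M W) (J : Set B)
    (f : ChainForm) : Set (MinRep cs J) :=
  {w | Chainlike w ∧ HasForm cs J f w}

end BWCoxeter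

end

/-! A form (I) element is the product along a chordless path `s_0, …, s_k` of the Coxeter graph that
starts at a black vertex and continues in `J`; the construction uses it as a stand-in for its end
vertex `s_k`. No braid relation applies anywhere in the word `s_k ⋯ s_0`, so it is the only reduced
word of its product and `s_k` is the only left descent. The words of forms (II) and (III) have the
same property, which is called `Rigid`. `Rigid.length_and_isLeftDescent` derives the consequences: a
second left descent would force a whole braid at the start of the word (`two_leftDescents`).

Nodes. Two form (I) elements are equivalent iff their paths end at the same vertex (`sim_iff`). By
the lifting property, a left descent of a minimal common upper bound can be stripped from the bound
and from those elements that have it as a descent; this compares `L(u,v)` with `L(u',v)` and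
`L(u,v')`.

Edges and labels. Comparing distances to the complement of `J` shows that every edge is either the
last step of such a path or joins the ends of two paths that differ only in the end vertex
(`exists_of_adj`). In the first case `u = v'` detects the edge. If `m ≥ 4`, the form (III) elements
above the form (II) element `s_{k-1} s_k s_{k-1} ⋯ s_0` are the alternating extensions with `p`
letters, `4 ≤ p < m`, so their number is `m - 4` (`encard_form_III`). In the second case `M_i(u,v)`
consists of the two alternating words with `i` letters on top of the common path, and these merge
exactly at `i = m` (`Fork.Mfun_eq`).

Two general facts on Coxeter groups carry all this: `s t` has order exactly `m(s,t)`, seen in the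
geometric representation, and the strong exchange property, which yields lifting in the Bruhat
order. -/

noncomputable section

namespace BWCoxeter

/-! ### The geometric representation -/

section GeometricRepresentation

variable {B : Type*} (M : CoxeterMatrix B)

/-- The entries `-2 cos (π / m(i,j))` of the Cartan matrix. -/
def cartan (i j : B) : ℝ := if M i j = 0 then -2 else -2 * Real.cos (Real.pi / M i j)

theorem cartan_self (i : B) : cartan M i i = 2 := by simp [cartan]

theorem cartan_comm (i j : B) : cartan M i j = cartan M j i := by
  simp only [cartan, M.symmetric i j]

/-- The simple coroot of index `i`. -/
def coroot (i : B) : Module.Dual ℝ (B →₀ ℝ) := Finsupp.linearCombination ℝ (cartan M i)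

theorem coroot_single (i j : B) : coroot M i (Finsupp.single j 1) = cartan M i j := by
  simp [coroot]

theorem coroot_root (i : B) : coroot M i (Finsupp.single i 1) = 2 := by
  rw [coroot_single, cartan_self]

/-- The simple reflection of index `i` in the geometric representation. -/
def geomReflection (i : B) : (B →₀ ℝ) ≃ₗ[ℝ] (B →₀ ℝ) := Module.reflection (coroot_root M i)

theorem cartan_sq {i j : B} (h : M i j ≠ 0) :
    cartan M i j * cartan M j i - 2 = 2 * Real.cos (2 * Real.pi / M i j) := by
  rw [cartan_comm M j i, cartan, if_neg h, mul_div_assoc, Real.cos_two_mul]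
  ring

theorem sin_two_pi_div_pos {n : ℕ} (h : 3 ≤ n) : 0 < Real.sin (2 * Real.pi / n) := by
  have hn : (3 : ℝ) ≤ n := by exact_mod_cast h
  apply Real.sin_pos_of_pos_of_lt_pi
  · positivity
  · rw [div_lt_iff₀ (by linarith)]
    nlinarith [Real.pi_pos]

open Polynomial.Chebyshev in
theorem eval_S_eq_zero {n : ℕ} (h : 3 ≤ n) {q : ℕ} (hq : n = 2 * q) :
    (S ℝ ((q : ℤ) - 1)).eval (2 * Real.cos (2 * Real.pi / n)) = 0 := by
  have h1 := S_two_mul_real_cos (2 * Real.pi / n) ((q : ℤ) - 1)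
  have hq0 : (q : ℝ) ≠ 0 := by
    have : q ≠ 0 := by omega
    exact_mod_cast this
  have h2 : ((((q : ℤ) - 1 : ℤ) : ℝ) + 1) * (2 * Real.pi / n) = Real.pi := by
    subst hq; push_cast; field_simp; ring
  rw [h2, Real.sin_pi] at h1
  exact (mul_eq_zero.1 h1).resolve_right (sin_two_pi_div_pos h).ne'

open Polynomial.Chebyshev in
theorem eval_S_add_eval_S_eq_zero {n : ℕ} (h : 3 ≤ n) {q : ℕ} (hq : n = 2 * q + 1) :
    (S ℝ (q : ℤ)).eval (2 * Real.cos (2 * Real.pi / n)) +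
      (S ℝ ((q : ℤ) - 1)).eval (2 * Real.cos (2 * Real.pi / n)) = 0 := by
  have h1 := S_two_mul_real_cos (2 * Real.pi / n) ((q : ℤ) - 1)
  have h2 := S_two_mul_real_cos (2 * Real.pi / n) (q : ℤ)
  have h3 : (((q : ℤ) : ℝ) + 1) * (2 * Real.pi / n) =
      2 * Real.pi - ((((q : ℤ) - 1 : ℤ) : ℝ) + 1) * (2 * Real.pi / n) := by
    subst hq; push_cast; field_simp; ring
  rw [h3, Real.sin_two_pi_sub] at h2
  refine (mul_eq_zero.1 ?_).resolve_right (sin_two_pi_div_pos h).ne'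
  rw [add_mul, h1, h2]; ring

/-- For `m ≥ 3` the power of a product of two reflections is written with Chebyshev polynomials at
`2 cos θ`, `θ = 2π/m`. Since `S_q(2 cos θ) sin θ = sin((q+1)θ)`, the coefficients vanish. For `m =
2` this fails to help, as `sin θ = 0`, and the product is computed directly. -/
theorem geomReflection_liftable : M.IsLiftable (geomReflection M) := by
  intro i j
  rcases eq_or_ne i j with rfl | hij
  · rw [M.diagonal, pow_one]
    ext1 v
    exact Module.involutive_reflection (coroot_root M i) v
  rcases Nat.eq_zero_or_pos (M i j) with h0 | h0
  · rw [h0, pow_zero]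
  have h1 : M i j ≠ 1 := M.off_diagonal i j hij
  rcases Nat.lt_or_ge (M i j) 3 with h2 | h3
  · have h2 : M i j = 2 := by omega
    have hc : cartan M i j = 0 := by simp [cartan, h2]
    have hc' : cartan M j i = 0 := by rw [cartan_comm, hc]
    ext1 v
    rw [h2, pow_two]
    simp only [LinearEquiv.mul_apply, geomReflection, Module.reflection_apply, map_sub, map_smul,
      coroot_single, cartan_self, hc, hc', LinearEquiv.coe_one, id]
    module
  · ext1 v
    rw [LinearEquiv.coe_one, id, geomReflection, geomReflection,
      Module.reflection_mul_reflection_pow_apply _ _ _ _ (2 * Real.cos (2 * Real.pi / M i j))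
      (by rw [coroot_single, coroot_single, cartan_sq M (by omega)])]
    obtain ⟨q, hq | hq⟩ := Nat.even_or_odd' (M i j)
    · have e1 : ((M i j : ℤ) - 2) / 2 = q - 1 := by omega
      have e2 : ((M i j : ℤ) - 1) / 2 = q - 1 := by omega
      rw [e1, e2, eval_S_eq_zero h3 hq]
      simp
    · have e1 : ((M i j : ℤ) - 2) / 2 = q - 1 := by omega
      have e2 : ((M i j : ℤ) - 1) / 2 = q := by omega
      have e3 : ((M i j : ℤ) - 3) / 2 = q - 1 := by omega
      have e4 : (M i j : ℤ) / 2 = q := by omega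
      rw [e1, e2, e3, e4, eval_S_add_eval_S_eq_zero h3 hq]
      simp

-- Apply the power to the simple root of index `i`. For `m ≥ 3` its coordinates force `sin(rθ) = 0`
-- and `cos(rθ) = 1` with `θ = 2π/m`, so `m` divides `r`. For `m = ∞` the coordinate at `j` is a
-- nonzero multiple of `r`.
open Polynomial.Chebyshev in
theorem geomReflection_pow_ne_one {i j : B} (hij : i ≠ j) {r : ℕ} (hr : 0 < r)
    (hM : M i j ≠ 0 → r < M i j) : (geomReflection M i * geomReflection M j) ^ r ≠ 1 := by
  intro h
  have h1 := LinearEquiv.congr_fun h (Finsupp.single i 1)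
  rw [geomReflection, geomReflection, Module.reflection_mul_reflection_pow_apply_self] at h1
  rw [coroot_single, coroot_single, LinearEquiv.coe_one, id] at h1
  have hi := DFunLike.congr_fun h1 i
  have hj := DFunLike.congr_fun h1 j
  simp [hij, hij.symm] at hi hj
  rcases eq_or_ne (M i j) 0 with h0 | h0
  · have hc : cartan M i j = -2 := by simp [cartan, h0]
    have hc' : cartan M j i = -2 := by rw [cartan_comm, hc]
    rw [hc, hc'] at hj
    norm_num [S_eval_two] at hj
    omega
  have hrM := hM h0
  have h1 : M i j ≠ 1 := M.off_diagonal i j hij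
  rw [cartan_sq M h0] at hi hj
  rcases Nat.lt_or_ge (M i j) 3 with h2 | h3
  · have h2 : M i j = 2 := by omega
    have hr1 : r = 1 := by omega
    subst hr1
    rw [h2] at hi
    norm_num at hi
  · have hs := sin_two_pi_div_pos h3
    have hc : cartan M j i ≠ 0 := by
      rw [cartan_comm, cartan, if_neg h0]
      have h3' : (3 : ℝ) ≤ M i j := by exact_mod_cast h3
      have : 0 < Real.cos (Real.pi / M i j) := by
        apply Real.cos_pos_of_mem_Ioo
        constructor
        · have : 0 < Real.pi / M i j := by positivity
          linarith [Real.pi_pos]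
        · apply div_lt_div_of_pos_left Real.pi_pos <;> linarith
      simp [this.ne']
    have hS := hj.resolve_right hc
    rw [hS, add_zero] at hi
    have e1 := S_two_mul_real_cos (2 * Real.pi / M i j) ((r : ℤ) - 1)
    have e2 := S_two_mul_real_cos (2 * Real.pi / M i j) (r : ℤ)
    rw [hS, zero_mul] at e1
    rw [hi, one_mul, add_mul, one_mul, Real.sin_add] at e2
    push_cast at e1 e2
    rw [sub_add_cancel] at e1
    rw [← e1, zero_mul, zero_add] at e2
    have hcos : Real.cos (r * (2 * Real.pi / M i j)) = 1 := by
      nlinarith [mul_right_cancel₀ hs.ne' ((one_mul _).trans e2)]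
    obtain ⟨n, hn⟩ := (Real.cos_eq_one_iff _).1 hcos
    have hMr : (M i j : ℝ) ≠ 0 := by exact_mod_cast h0
    field_simp at hn
    have hn' : n * (M i j : ℤ) = r := by
      have := hn
      exact_mod_cast this
    have hn0 : 0 < n := by
      by_contra hcon
      have : n * (M i j : ℤ) ≤ 0 := mul_nonpos_of_nonpos_of_nonneg (by omega) (by omega)
      omega
    nlinarith

end GeometricRepresentation

variable {B W : Type*} [Group W] {M : CoxeterMatrix B} (cs : CoxeterSystem M W)

theorem simple_mul_simple_pow_ne_one {i j : B} (hij : i ≠ j) {r : ℕ} (hr : 0 < r)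
    (hM : M i j ≠ 0 → r < M i j) : (cs.simple i * cs.simple j) ^ r ≠ 1 := by
  intro h
  apply geomReflection_pow_ne_one M hij hr hM
  have := congrArg (cs.lift ⟨_, geomReflection_liftable M⟩) h
  rwa [map_pow, map_mul, cs.lift_apply_simple, cs.lift_apply_simple, map_one] at this

theorem simple_injective : Function.Injective cs.simple := by
  intro i j h
  by_contra hij
  refine simple_mul_simple_pow_ne_one cs hij one_pos (fun h0 => ?_) ?_
  · have := M.off_diagonal i j hij
    omega
  · rw [h, pow_one, cs.simple_mul_simple_self]

/-! ### The strong exchange property -/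

section StrongExchange

open scoped Classical in
/-- The action of a simple reflection on pairs of a group element and a sign. -/
def signedConj {B W : Type*} [Group W] {M : CoxeterMatrix B} (cs : CoxeterSystem M W) (i : B) :
    Function.End (W × ZMod 2) :=
  fun p => (cs.simple i * p.1 * cs.simple i, p.2 + if p.1 = cs.simple i then 1 else 0)

variable {B W : Type*} [Group W] {M : CoxeterMatrix B} (cs : CoxeterSystem M W)

theorem pow_mul_simple_mul_pow (i j : B) (n : ℕ) :
    (cs.simple i * cs.simple j) ^ n * cs.simple j * (cs.simple i * cs.simple j) ^ n =
      cs.simple j := by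
  induction n with
  | zero => simp
  | succ n ih =>
    nth_rewrite 1 [pow_succ]
    rw [pow_succ']
    simpa [mul_assoc] using ih

theorem conj_pow_eq_iff (i j : B) (n : ℕ) (t : W) :
    (cs.simple i * cs.simple j) ^ n * t * ((cs.simple i * cs.simple j) ^ n)⁻¹ = cs.simple j ↔
      t = cs.simple j * (cs.simple i * cs.simple j) ^ (2 * n) := by
  have h := pow_mul_simple_mul_pow cs i j n
  rw [mul_inv_eq_iff_eq_mul, two_mul, pow_add, ← mul_assoc]
  nth_rewrite 2 [← h]
  rw [mul_assoc, mul_assoc, mul_right_inj]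
  simp only [mul_assoc]

theorem simple_conj_pow_eq_iff (i j : B) (n : ℕ) (t : W) :
    cs.simple j * ((cs.simple i * cs.simple j) ^ n * t * ((cs.simple i * cs.simple j) ^ n)⁻¹) *
      cs.simple j = cs.simple i ↔
      t = cs.simple j * (cs.simple i * cs.simple j) ^ (2 * n + 1) := by
  have h := pow_mul_simple_mul_pow cs i j n
  have e1 : ∀ x : W, cs.simple j * x * cs.simple j = cs.simple i ↔
      x = cs.simple j * (cs.simple i * cs.simple j) := by
    intro x
    constructor
    · intro hx; rw [← hx]; simp [mul_assoc]
    · rintro rfl; simp [mul_assoc]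
  have e2 : 2 * n + 1 = n + (1 + n) := by ring
  rw [e1, mul_inv_eq_iff_eq_mul, e2, pow_add _ n, pow_add _ 1, pow_one]
  nth_rewrite 2 [← h]
  simp only [mul_assoc, mul_right_inj]

open scoped Classical in
theorem signedConj_mul_pow (i j : B) (n : ℕ) (t : W) (ε : ZMod 2) :
    ((signedConj cs i * signedConj cs j) ^ n) (t, ε) =
      ((cs.simple i * cs.simple j) ^ n * t * ((cs.simple i * cs.simple j) ^ n)⁻¹,
        ε + ∑ e ∈ Finset.range (2 * n),
          if t = cs.simple j * (cs.simple i * cs.simple j) ^ e then 1 else 0) := by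
  induction n with
  | zero => simp; rfl
  | succ n ih =>
    have e2 : 2 * (n + 1) = 2 * n + 1 + 1 := by ring
    have : ((signedConj cs i * signedConj cs j) ^ (n + 1)) (t, ε) =
      signedConj cs i (signedConj cs j (((signedConj cs i * signedConj cs j) ^ n) (t, ε))) := by
      rw [pow_succ']; rfl
    rw [this, ih, e2, Finset.sum_range_succ, Finset.sum_range_succ]
    simp only [signedConj, conj_pow_eq_iff, simple_conj_pow_eq_iff]
    ext1
    · simp only [pow_succ' _ n, mul_inv_rev, cs.inv_simple]
      simp only [mul_assoc]
    · simp only [add_assoc]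

/-- If `(s_i s_j)^n = 1`, the elements `s_j (s_i s_j)^e` repeat with period `n`. Over `e < 2n` each
is therefore met an even number of times, and the signs cancel. -/
theorem signedConj_liftable : M.IsLiftable (signedConj cs) := by
  intro i j
  have h := cs.simple_mul_simple_pow i j
  have key : ∀ n : ℕ, (cs.simple i * cs.simple j) ^ n = 1 →
      (signedConj cs i * signedConj cs j) ^ n = 1 := by
    intro n hn
    funext ⟨t, ε⟩
    rw [signedConj_mul_pow, two_mul, Finset.sum_range_add]
    have e : ∀ x, (cs.simple i * cs.simple j) ^ (n + x) = (cs.simple i * cs.simple j) ^ x := by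
      intro x
      rw [pow_add, hn, one_mul]
    have h2 : ∀ a b : ZMod 2, a = b → ε + (a + b) = ε := by
      rintro a _ rfl
      rw [CharTwo.add_self_eq_zero, add_zero]
    exact Prod.ext (by simp [hn]; rfl) (h2 _ _ (Finset.sum_congr rfl fun x _ => by rw [e x]))
  exact key _ h

/-- The action of the Coxeter group on pairs of a group element and a sign. -/
def signedConjHom : W →* Function.End (W × ZMod 2) := cs.lift ⟨_, signedConj_liftable cs⟩

theorem signedConjHom_simple (i : B) (p : W × ZMod 2) :
    signedConjHom cs (cs.simple i) p = signedConj cs i p := by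
  rw [signedConjHom, cs.lift_apply_simple]

theorem signedConjHom_mul (u v : W) (p : W × ZMod 2) :
    signedConjHom cs (u * v) p = signedConjHom cs u (signedConjHom cs v p) := by
  rw [map_mul]; rfl

theorem signedConjHom_one (p : W × ZMod 2) : signedConjHom cs 1 p = p := by
  rw [map_one]; rfl

-- Since the left side depends only on the product, so does the parity of the number of occurrences
-- of `t` in the inversion sequence. The signed action is introduced for this.
open scoped Classical in
theorem signedConjHom_wordProd (ω : List B) (t : W) (ε : ZMod 2) :
    signedConjHom cs (cs.wordProd ω) (t, ε) =
      (cs.wordProd ω * t * (cs.wordProd ω)⁻¹, ε + ((cs.rightInvSeq ω).count t : ZMod 2)) := by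
  induction ω with
  | nil => simp [signedConjHom_one]
  | cons i ω ih =>
    rw [cs.wordProd_cons, signedConjHom_mul, ih, signedConjHom_simple, signedConj]
    ext1
    · simp [mul_assoc]
    · rw [CoxeterSystem.rightInvSeq, List.count_cons]
      have : ((cs.wordProd ω)⁻¹ * cs.simple i * cs.wordProd ω = t) ↔
          (cs.wordProd ω * t * (cs.wordProd ω)⁻¹ = cs.simple i) := by
        constructor
        · rintro rfl; group
        · intro h; rw [← h]; group
      simp only [beq_iff_eq, this]
      push_cast
      rw [add_assoc]

/-- The sign that `w` gives to `t`. -/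
def inversionSign (w t : W) : ZMod 2 := (signedConjHom cs w (t, 0)).2

open scoped Classical in
theorem inversionSign_wordProd (ω : List B) (t : W) :
    inversionSign cs (cs.wordProd ω) t = ((cs.rightInvSeq ω).count t : ZMod 2) := by
  rw [inversionSign, signedConjHom_wordProd, zero_add]

theorem signedConjHom_apply (w t : W) (ε : ZMod 2) :
    signedConjHom cs w (t, ε) = (w * t * w⁻¹, ε + inversionSign cs w t) := by
  obtain ⟨ω, rfl⟩ := cs.wordProd_surjective w
  rw [signedConjHom_wordProd, inversionSign_wordProd]

theorem inversionSign_mul (u v t : W) :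
    inversionSign cs (u * v) t = inversionSign cs v t + inversionSign cs u (v * t * v⁻¹) := by
  rw [inversionSign, signedConjHom_mul, signedConjHom_apply cs v, signedConjHom_apply, zero_add]

theorem inversionSign_one (t : W) : inversionSign cs 1 t = 0 := by
  rw [inversionSign, signedConjHom_one]

theorem inversionSign_simple_self (i : B) :
    inversionSign cs (cs.simple i) (cs.simple i) = 1 := by
  rw [inversionSign, signedConjHom_simple, signedConj]
  simp

theorem inversionSign_self {t : W} (ht : cs.IsReflection t) : inversionSign cs t t = 1 := by
  obtain ⟨x, i, rfl⟩ := ht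
  rw [inversionSign_mul, inversionSign_mul]
  have h := inversionSign_mul cs x x⁻¹ (x * cs.simple i * x⁻¹)
  rw [mul_inv_cancel, inversionSign_one] at h
  have e1 : x⁻¹ * (x * cs.simple i * x⁻¹) * x⁻¹⁻¹ = cs.simple i := by group
  rw [e1] at h ⊢
  rw [cs.inv_simple, cs.simple_mul_simple_cancel_right, inversionSign_simple_self]
  linear_combination -h

theorem inversionSign_mul_self {t : W} (ht : cs.IsReflection t) (w : W) :
    inversionSign cs (w * t) t = 1 + inversionSign cs w t := by
  rw [inversionSign_mul, inversionSign_self cs ht, mul_inv_cancel_right]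

open scoped Classical in
theorem mem_rightInvSeq_of_inversionSign {ω : List B} {t : W}
    (h : inversionSign cs (cs.wordProd ω) t = 1) : t ∈ cs.rightInvSeq ω := by
  rw [inversionSign_wordProd] at h
  by_contra hcon
  rw [List.count_eq_zero_of_not_mem hcon] at h
  simp at h

theorem length_lt_of_inversionSign {w t : W} (h : inversionSign cs w t = 1) :
    cs.length (w * t) < cs.length w := by
  obtain ⟨ω, hω, rfl⟩ := cs.exists_isReduced w
  exact (cs.isRightInversion_of_mem_rightInvSeq hω (mem_rightInvSeq_of_inversionSign cs h)).2

/-- Were the sign of `w` at `t` zero, that of `w t` would be one, so `t` would shorten `w t` to `w`.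
-/
theorem inversionSign_eq_one {w t : W} (ht : cs.IsReflection t)
    (h : cs.length (w * t) < cs.length w) : inversionSign cs w t = 1 := by
  have h01 : ∀ x : ZMod 2, x = 0 ∨ x = 1 := by decide
  refine (h01 _).resolve_left fun h0 => ?_
  have h1 := inversionSign_mul_self cs ht w
  rw [h0, add_zero] at h1
  have h2 := length_lt_of_inversionSign cs h1
  rw [mul_assoc, ht.mul_self, mul_one] at h2
  omega

/-- The strong exchange property. -/
theorem strong_exchange {ω : List B} {t : W} (ht : cs.IsReflection t)
    (h : cs.length (cs.wordProd ω * t) < cs.length (cs.wordProd ω)) :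
    ∃ j < ω.length, cs.wordProd ω * t = cs.wordProd (ω.eraseIdx j) := by
  obtain ⟨j, hj, rfl⟩ := List.getElem_of_mem
    (mem_rightInvSeq_of_inversionSign cs (inversionSign_eq_one cs ht h))
  refine ⟨j, by simpa using hj, ?_⟩
  rw [← cs.wordProd_mul_getD_rightInvSeq, List.getD_eq_getElem _ _ hj]

/-- The exchange property for left multiplication by a simple reflection. -/
theorem left_exchange {ω : List B} {i : B} (h : cs.IsLeftDescent (cs.wordProd ω) i) :
    ∃ α b β, ω = α ++ b :: β ∧ cs.simple i * cs.wordProd ω = cs.wordProd (α ++ β) := by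
  have h' : cs.length (cs.wordProd ω * ((cs.wordProd ω)⁻¹ * cs.simple i * cs.wordProd ω)) <
      cs.length (cs.wordProd ω) := by
    simpa [← mul_assoc, CoxeterSystem.IsLeftDescent] using h
  have ht : cs.IsReflection ((cs.wordProd ω)⁻¹ * cs.simple i * cs.wordProd ω) := by
    simpa using (cs.isReflection_simple i).conj (cs.wordProd ω)⁻¹
  obtain ⟨j, hj, e⟩ := strong_exchange cs ht h'
  refine ⟨ω.take j, ω[j], ω.drop (j + 1), by simp, ?_⟩
  rw [← List.eraseIdx_eq_take_drop_succ, ← e]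
  simp [← mul_assoc]

end StrongExchange

/-! ### Lifting in the Bruhat order -/

section Bruhat

variable {B W : Type*} [Group W] {M : CoxeterMatrix B} {cs : CoxeterSystem M W}

theorem BruhatLE.refl (w : W) : BruhatLE cs w w := Relation.ReflTransGen.refl

theorem BruhatLE.trans {u v w : W} (h₁ : BruhatLE cs u v) (h₂ : BruhatLE cs v w) :
    BruhatLE cs u w := Relation.ReflTransGen.trans h₁ h₂

theorem BruhatLE.length_le {u v : W} (h : BruhatLE cs u v) : cs.length u ≤ cs.length v := by
  rcases h.eq_or_length_lt with rfl | h
  · exact le_rfl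
  · exact h.le

theorem BruhatLE.eq_of_length_le {u v : W} (h : BruhatLE cs u v)
    (hl : cs.length v ≤ cs.length u) : u = v :=
  h.eq_or_length_lt.resolve_right (by omega)

theorem BruhatLE.mul_simple {w : W} {i : B} (h : ¬cs.IsRightDescent w i) :
    BruhatLE cs w (w * cs.simple i) :=
  Relation.ReflTransGen.single ⟨_, cs.isReflection_simple i, rfl, by
    rw [cs.not_isRightDescent_iff] at h; omega⟩

theorem BruhatLE.inv {u v : W} (h : BruhatLE cs u v) : BruhatLE cs u⁻¹ v⁻¹ := by
  induction h with
  | refl => exact .refl _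
  | tail _ hstep ih =>
    rename_i b c _
    obtain ⟨t, ht, rfl, hlt⟩ := hstep
    refine ih.tail ⟨b * t * b⁻¹, ht.conj b, ?_, by simpa only [cs.length_inv] using hlt⟩
    rw [mul_inv_rev, ht.inv]
    group

theorem BruhatLE.simple_mul {w : W} {i : B} (h : ¬cs.IsLeftDescent w i) :
    BruhatLE cs w (cs.simple i * w) := by
  have := (BruhatLE.mul_simple (mt cs.isRightDescent_inv_iff.1 h)).inv
  simpa using this

theorem BruhatLE.of_isLeftDescent {w : W} {i : B} (h : cs.IsLeftDescent w i) :
    BruhatLE cs (cs.simple i * w) w := by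
  have := BruhatLE.simple_mul (cs.isLeftDescent_iff_not_isLeftDescent_mul.1 h)
  simpa using this

/-- If the step does not survive, then `s_i u t` is shorter than `s_i u`, and `u t` has a reduced
word beginning with `i`. Strong exchange obtains `u` by deleting a letter: the first one gives `s_i
u = u t`, any other would make `s_i u` too short. -/
theorem BruhatStep.simple_mul {u v : W} (h : BruhatStep cs u v) (i : B) :
    cs.simple i * u = v ∨ BruhatStep cs (cs.simple i * u) (cs.simple i * v) := by
  obtain ⟨t, ht, rfl, hlt⟩ := h
  by_cases hl : cs.length (cs.simple i * u) < cs.length (cs.simple i * (u * t))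
  · exact Or.inr ⟨t, ht, (mul_assoc _ _ _).symm, hl⟩
  left
  have hne := ht.length_mul_left_ne (cs.simple i * u)
  rw [mul_assoc] at hne
  have h1 := cs.length_simple_mul u i
  have h2 := cs.length_simple_mul (u * t) i
  obtain ⟨ω, hω, e⟩ := cs.exists_isReduced (cs.simple i * (u * t))
  have hω' : cs.length (cs.simple i * (u * t)) = ω.length := by rw [e]; exact hω
  have e' : cs.wordProd (i :: ω) = u * t := by rw [cs.wordProd_cons, ← e]; simp
  have h3 : cs.length (cs.wordProd (i :: ω) * t) < cs.length (cs.wordProd (i :: ω)) := by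
    rw [e', mul_assoc, ht.mul_self, mul_one]; exact hlt
  obtain ⟨j, hj, ej⟩ := strong_exchange cs ht h3
  rw [e', mul_assoc, ht.mul_self, mul_one] at ej
  cases j with
  | zero =>
    rw [List.eraseIdx_cons_zero] at ej
    rw [← e', cs.wordProd_cons, ← ej]
  | succ j =>
    exfalso
    rw [List.eraseIdx_cons_succ, cs.wordProd_cons] at ej
    have h4 := cs.length_wordProd_le (ω.eraseIdx j)
    have h5 : cs.wordProd (ω.eraseIdx j) = cs.simple i * u := by rw [ej]; simp
    rw [h5, List.length_eraseIdx] at h4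
    simp only [List.length_cons] at hj
    split_ifs at h4 <;> omega

open scoped Classical in
/-- The larger one of `w` and `s_i w`. -/
def up (cs : CoxeterSystem M W) (i : B) (w : W) : W :=
  if cs.IsLeftDescent w i then w else cs.simple i * w

open scoped Classical in
/-- The smaller one of `w` and `s_i w`. -/
def low (cs : CoxeterSystem M W) (i : B) (w : W) : W :=
  if cs.IsLeftDescent w i then cs.simple i * w else w

theorem le_up (i : B) (w : W) : BruhatLE cs w (up cs i w) := by
  unfold up
  split_ifs with h
  · exact .refl _
  · exact .simple_mul h

theorem simple_mul_le_up (i : B) (w : W) : BruhatLE cs (cs.simple i * w) (up cs i w) := by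
  unfold up
  split_ifs with h
  · exact .of_isLeftDescent h
  · exact .refl _

theorem low_le (i : B) (w : W) : BruhatLE cs (low cs i w) w := by
  unfold low
  split_ifs with h
  · exact .of_isLeftDescent h
  · exact .refl _

theorem low_le_simple_mul (i : B) (w : W) : BruhatLE cs (low cs i w) (cs.simple i * w) := by
  unfold low
  split_ifs with h
  · exact .refl _
  · exact .simple_mul h

theorem up_simple_mul (i : B) (w : W) : up cs i (cs.simple i * w) = up cs i w := by
  unfold up
  rw [cs.isLeftDescent_iff_not_isLeftDescent_mul (w := w)]
  by_cases h : cs.IsLeftDescent (cs.simple i * w) i <;> simp [h]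

theorem low_simple_mul (i : B) (w : W) : low cs i (cs.simple i * w) = low cs i w := by
  unfold low
  rw [cs.isLeftDescent_iff_not_isLeftDescent_mul (w := w)]
  by_cases h : cs.IsLeftDescent (cs.simple i * w) i <;> simp [h]

theorem length_up_le (i : B) (w : W) : cs.length (up cs i w) ≤ cs.length w + 1 := by
  unfold up
  split_ifs with h
  · omega
  · rw [cs.not_isLeftDescent_iff] at h; omega

/-- The lifting property, phrased as monotonicity of the larger element of `{w, s_i w}`. A Bruhat
step either survives multiplication by `s_i` or joins `w` to `s_i w`, which have the same image. -/
theorem BruhatLE.up {u v : W} (h : BruhatLE cs u v) (i : B) :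
    BruhatLE cs (up cs i u) (up cs i v) := by
  induction h with
  | refl => exact .refl _
  | tail _ hstep ih =>
    refine ih.trans ?_
    rename_i b c _
    rcases hstep.simple_mul i with h | h
    · rw [← h, up_simple_mul]; exact .refl _
    · conv_lhs => unfold BWCoxeter.up
      split_ifs
      · exact BruhatLE.trans (.single hstep) (le_up i c)
      · exact BruhatLE.trans (.single h) (simple_mul_le_up i c)

theorem BruhatLE.low {u v : W} (h : BruhatLE cs u v) (i : B) :
    BruhatLE cs (low cs i u) (low cs i v) := by
  induction h with
  | refl => exact .refl _
  | tail _ hstep ih =>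
    refine ih.trans ?_
    rename_i b c _
    rcases hstep.simple_mul i with h | h
    · rw [← h, low_simple_mul]; exact .refl _
    · conv_rhs => unfold BWCoxeter.low
      split_ifs
      · exact BruhatLE.trans (low_le_simple_mul i b) (.single h)
      · exact BruhatLE.trans (low_le i b) (.single hstep)

theorem BruhatLE.le_simple_mul_of_not_isLeftDescent {u w : W} {i : B} (h : BruhatLE cs u w)
    (hw : cs.IsLeftDescent w i) (hu : ¬cs.IsLeftDescent u i) :
    BruhatLE cs u (cs.simple i * w) := by
  simpa [BWCoxeter.low, hw, hu] using h.low i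

theorem BruhatLE.simple_mul_le_simple_mul {u w : W} {i : B} (h : BruhatLE cs u w)
    (hu : cs.IsLeftDescent u i) : BruhatLE cs (cs.simple i * u) (cs.simple i * w) := by
  have h1 := h.low i
  rw [BWCoxeter.low, if_pos hu] at h1
  exact h1.trans (low_le_simple_mul i w)

theorem BruhatLE.simple_mul_le_simple_mul_of_not {u w : W} {i : B} (h : BruhatLE cs u w)
    (hw : ¬cs.IsLeftDescent w i) : BruhatLE cs (cs.simple i * u) (cs.simple i * w) := by
  have h1 := h.up i
  rw [BWCoxeter.up.eq_def cs i w, if_neg hw] at h1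
  exact (simple_mul_le_up i u).trans h1

theorem BruhatLE.le_mul_simple_of_not_isRightDescent {u w : W} {j : B} (h : BruhatLE cs u w)
    (hw : cs.IsRightDescent w j) (hu : ¬cs.IsRightDescent u j) :
    BruhatLE cs u (w * cs.simple j) := by
  have := (h.inv.le_simple_mul_of_not_isLeftDescent (cs.isLeftDescent_inv_iff.2 hw)
    (mt cs.isLeftDescent_inv_iff.1 hu)).inv
  simpa using this

theorem one_bruhatLE (w : W) : BruhatLE cs 1 w := by
  induction hm : cs.length w generalizing w with
  | zero => obtain rfl := cs.length_eq_zero_iff.1 hm; exact .refl _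
  | succ m ih =>
    obtain ⟨i, hi⟩ := cs.exists_leftDescent_of_ne_one (w := w) (by rintro rfl; simp at hm)
    have := cs.isLeftDescent_iff.1 hi
    exact (ih (cs.simple i * w) (by omega)).trans (.of_isLeftDescent hi)

theorem bruhat_directed (u v : W) : ∃ w, BruhatLE cs u w ∧ BruhatLE cs v w := by
  induction hn : cs.length u generalizing u with
  | zero =>
    obtain rfl := cs.length_eq_zero_iff.1 hn
    exact ⟨v, one_bruhatLE v, .refl _⟩
  | succ n ih =>
    obtain ⟨i, hi⟩ := cs.exists_leftDescent_of_ne_one (w := u) (by rintro rfl; simp at hn)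
    have := cs.isLeftDescent_iff.1 hi
    obtain ⟨w, h1, h2⟩ := ih (cs.simple i * u) (by omega)
    refine ⟨up cs i w, ?_, h2.trans (le_up i w)⟩
    have := h1.up i
    rw [up_simple_mul] at this
    exact (le_up i u).trans this

/-- If `s_i z > z` has a right descent that `z` does not have, then `s_i z = z s_j`. -/
theorem simple_mul_eq_mul_simple {z : W} {i j : B}
    (hj : ¬cs.IsRightDescent z j) (h : cs.IsRightDescent (cs.simple i * z) j) :
    cs.simple i * z = z * cs.simple j := by
  have hs : BruhatStep cs (cs.simple i * z * cs.simple j) (cs.simple i * z) :=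
    ⟨_, cs.isReflection_simple j, by simp, h⟩
  rcases hs.simple_mul i with h1 | h1
  · rw [← h1]; simp [mul_assoc]
  · obtain ⟨-, -, -, h2⟩ := h1
    rw [cs.not_isRightDescent_iff] at hj
    simp only [← mul_assoc, cs.simple_mul_simple_self, one_mul] at h2
    omega

/-! ### Alternating prefixes and dihedral subgroups -/

/-- The product `s_a s_c s_a ⋯` with `q` factors. -/
def altProd (cs : CoxeterSystem M W) : B → B → ℕ → W
  | _, _, 0 => 1
  | a, c, q + 1 => cs.simple a * altProd cs c a q

/-- The last clause lists the reflections whose left multiplication deletes a letter of the word; it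
serves to rule out such deletions in `exists_altProd_mul`. -/
theorem altProd_eq_wordProd (a c : B) (q : ℕ) : ∃ ω : List B, ω.length = q ∧
    altProd cs a c q = cs.wordProd ω ∧ ∀ α b β, ω = α ++ b :: β → ∃ r < q,
      cs.wordProd α * cs.simple b * (cs.wordProd α)⁻¹ =
        (cs.simple a * cs.simple c) ^ r * cs.simple a := by
  induction q generalizing a c with
  | zero => exact ⟨[], rfl, rfl, by simp⟩
  | succ q ih =>
    obtain ⟨ω, h1, h2, h3⟩ := ih c a
    refine ⟨a :: ω, by simp [h1], by rw [altProd, h2, cs.wordProd_cons], ?_⟩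
    intro α b β e
    cases α with
    | nil =>
      simp only [List.nil_append, List.cons.injEq] at e
      exact ⟨0, by omega, by simp [e.1]⟩
    | cons d α =>
      simp only [List.cons_append, List.cons.injEq] at e
      obtain ⟨rfl, e⟩ := e
      obtain ⟨r, hr, e'⟩ := h3 α b β e
      refine ⟨r + 1, by omega, ?_⟩
      rw [cs.wordProd_cons, mul_inv_rev, cs.inv_simple]
      calc _ = cs.simple a * (cs.wordProd α * cs.simple b * (cs.wordProd α)⁻¹) *
            cs.simple a := by simp only [mul_assoc]
        _ = _ := by
          rw [e', pow_succ, ← mul_assoc, ← mul_assoc, mul_pow_mul]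

/-- By induction `v` begins with `q` letters `s_c s_a ⋯`, and `a` is a left descent. If exchange
deletes a letter behind this prefix, the prefix grows by `s_a`. A deletion inside the prefix would
give `s_a = (s_c s_a)^r s_c` with `r < q`, against the exact order of `s_c s_a`. -/
theorem exists_altProd_mul {v : W} {a c : B} (hac : a ≠ c) (ha : cs.IsLeftDescent v a)
    (hc : cs.IsLeftDescent v c) (q : ℕ) (hq : M a c ≠ 0 → q ≤ M a c) :
    ∃ y, v = altProd cs a c q * y ∧ cs.length v = q + cs.length y := by
  induction q generalizing a c with
  | zero => exact ⟨v, by simp [altProd], by simp⟩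
  | succ q ih =>
    obtain ⟨y, e, hl⟩ := ih hac.symm hc ha (by rw [M.symmetric]; omega)
    obtain ⟨ω, h1, h2, h3⟩ := altProd_eq_wordProd (cs := cs) c a q
    obtain ⟨η, hη, hy⟩ := cs.exists_isReduced y
    have hv : v = cs.wordProd (ω ++ η) := by rw [e, h2, hy, cs.wordProd_append]
    have ha' := ha
    rw [hv] at ha'
    obtain ⟨α, b, β, e1, e2⟩ := left_exchange cs ha'
    rw [← hv] at e2
    rw [List.append_eq_append_iff] at e1
    have case2 : ∀ γ, α = ω ++ γ → η = γ ++ b :: β →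
        ∃ y, v = altProd cs a c (q + 1) * y ∧ cs.length v = q + 1 + cs.length y := by
      rintro γ rfl rfl
      have hy' : cs.length y = (γ ++ b :: β).length := by rw [hy]; exact hη
      refine ⟨cs.wordProd (γ ++ β), ?_, ?_⟩
      · rw [altProd, h2, mul_assoc, ← cs.wordProd_append, ← List.append_assoc, ← e2]
        simp
      · have l1 := cs.length_wordProd_le (γ ++ β)
        have l2 := cs.length_wordProd_le (a :: (ω ++ (γ ++ β)))
        have e3 : cs.wordProd (a :: (ω ++ (γ ++ β))) = v := by
          rw [cs.wordProd_cons, ← List.append_assoc, ← e2]; simp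
        have l3 := cs.length_mul_le (cs.wordProd (a :: ω)) (cs.wordProd (γ ++ β))
        have l4 := cs.length_wordProd_le (a :: ω)
        rw [← cs.wordProd_append, List.cons_append, e3] at l3
        simp only [List.length_append, List.length_cons] at *
        omega
    rcases e1 with ⟨γ, hα, hη'⟩ | ⟨γ, hω, hβ⟩
    · exact case2 γ hα hη'
    · cases γ with
      | nil => exact case2 [] (by simpa using hω.symm) (by simpa using hβ.symm)
      | cons d γ =>
        exfalso
        simp only [List.cons_append, List.cons.injEq] at hβ
        obtain ⟨rfl, rfl⟩ := hβ
        obtain ⟨r, hr, e3⟩ := h3 α b γ hω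
        have e4 : cs.simple a = cs.wordProd α * cs.simple b * (cs.wordProd α)⁻¹ := by
          rw [hv, hω] at e2
          simp only [cs.wordProd_append, cs.wordProd_cons, List.append_assoc,
            List.cons_append] at e2
          have e5 : cs.simple a * cs.wordProd α * cs.simple b = cs.wordProd α := by
            refine mul_right_cancel (b := cs.wordProd γ * cs.wordProd η) ?_
            rw [← e2]
            simp only [mul_assoc]
          nth_rewrite 1 [← e5]
          simp [mul_assoc]
        rw [e3] at e4
        apply simple_mul_simple_pow_ne_one cs hac.symm (r := r + 1) (by omega)
        · intro h; rw [M.symmetric] at h ⊢; specialize hq h; omega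
        · rw [pow_succ, ← mul_assoc, ← e4, cs.simple_mul_simple_self]

/-- An element with two left descents `a` and `c` starts with the longest element of the dihedral
subgroup that they generate. -/
theorem two_leftDescents {v : W} {a c : B} (hac : a ≠ c) (ha : cs.IsLeftDescent v a)
    (hc : cs.IsLeftDescent v c) : M a c ≠ 0 ∧
    ∃ y, v = altProd cs a c (M a c) * y ∧ cs.length v = M a c + cs.length y := by
  refine ⟨fun h => ?_, exists_altProd_mul hac ha hc _ fun _ => le_rfl⟩
  -- For `m = ∞` alternating prefixes of every length would exist, even one longer than `v`.
  obtain ⟨y, -, hl⟩ := exists_altProd_mul hac ha hc (cs.length v + 1) (by simp [h])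
  omega

end Bruhat

/-! ### Minimal coset representatives -/

section MinRep

variable {B W : Type*} [Group W] {M : CoxeterMatrix B} {cs : CoxeterSystem M W} {J : Set B}

/-- No element of `J` is a right descent of `w`. -/
def IsMin (cs : CoxeterSystem M W) (J : Set B) (w : W) : Prop :=
  ∀ j ∈ J, ¬cs.IsRightDescent w j

theorem isMin_iff {w : W} : IsMin cs J w ↔ ∀ (ω : List B) (j : B), cs.IsReduced (ω ++ [j]) →
    cs.wordProd (ω ++ [j]) = w → j ∉ J := by
  constructor
  · rintro h ω j hω rfl hj
    apply h j hj
    have h1 := hω.eq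
    have h2 := cs.length_wordProd_le ω
    rw [cs.wordProd_append, cs.wordProd_singleton] at h1 ⊢
    rw [CoxeterSystem.IsRightDescent, cs.simple_mul_simple_cancel_right, h1]
    simp only [List.length_append, List.length_singleton]
    omega
  · intro h j hj hd
    obtain ⟨ω, hω, e⟩ := cs.exists_isReduced (w * cs.simple j)
    have h1 : cs.wordProd (ω ++ [j]) = w := by
      rw [cs.wordProd_append, ← e]; simp
    refine h ω j ?_ h1 hj
    rw [CoxeterSystem.IsReduced, h1]
    rw [cs.isRightDescent_iff, e, hω.eq] at hd
    simp [hd]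

theorem MinRep.eq_iff {u v : MinRep cs J} : u = v ↔ u.1 = v.1 := Subtype.ext_iff

theorem MinRep.isMin (w : MinRep cs J) : IsMin cs J w.1 := isMin_iff.2 w.2

/-- The element of `W^J` given by an element of `W` without right descents in `J`. -/
def IsMin.toMinRep {w : W} (h : IsMin cs J w) : MinRep cs J := ⟨w, isMin_iff.1 h⟩

theorem IsMin.simple_mul {w : W} (h : IsMin cs J w) {i : B} (hi : cs.IsLeftDescent w i) :
    IsMin cs J (cs.simple i * w) := by
  intro j hj hd
  apply h j hj
  rw [cs.isLeftDescent_iff] at hi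
  rw [CoxeterSystem.IsRightDescent, mul_assoc] at hd
  have := cs.length_simple_mul (w * cs.simple j) i
  rw [CoxeterSystem.IsRightDescent]
  omega

/-- Right descents in `J` are stripped one by one; by lifting, the elements of `W^J` below `w` stay
below. Hence the upper bounds in the definition of `L` may range over `W` instead of `W^J`. -/
theorem exists_isMin_le (J : Set B) (w : W) : ∃ w', IsMin cs J w' ∧ BruhatLE cs w' w ∧
    ∀ u, IsMin cs J u → BruhatLE cs u w → BruhatLE cs u w' := by
  induction hn : cs.length w generalizing w with
  | zero =>
    obtain rfl := cs.length_eq_zero_iff.1 hn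
    exact ⟨1, fun j _ => cs.not_isRightDescent_one j, .refl _, fun _ _ h => h⟩
  | succ n ih =>
    by_cases h : IsMin cs J w
    · exact ⟨w, h, .refl _, fun _ _ h => h⟩
    · simp only [IsMin, not_forall, not_not] at h
      obtain ⟨j, hj, hd⟩ := h
      have hd' := cs.isRightDescent_iff.1 hd
      obtain ⟨w', h1, h2, h3⟩ := ih (w * cs.simple j) (by omega)
      refine ⟨w', h1, h2.trans ?_, fun u hu huw =>
        h3 u hu (huw.le_mul_simple_of_not_isRightDescent hd (hu j hj))⟩
      have := BruhatLE.mul_simple (cs.isRightDescent_iff_not_isRightDescent_mul.1 hd)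
      simpa using this

theorem MinRep.length_strictMono {u v : MinRep cs J} (h : u < v) :
    cs.length u.1 < cs.length v.1 := by
  rcases BruhatLE.eq_or_length_lt (show BruhatLE cs u.1 v.1 from h.le) with e | h'
  · exact absurd (Subtype.ext e) h.ne
  · exact h'

theorem MinRep.covBy {u v : MinRep cs J} (h : BruhatLE cs u.1 v.1)
    (hl : cs.length v.1 = cs.length u.1 + 1) : u ⋖ v := by
  refine ⟨lt_of_le_of_ne h ?_, fun c hu hv => ?_⟩
  · rintro rfl; omega
  · have h1 := MinRep.length_strictMono hu
    have h2 := MinRep.length_strictMono hv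
    omega

theorem MinRep.covBy_simple_mul {u v : MinRep cs J} {i : B} (hu : ¬cs.IsLeftDescent u.1 i)
    (h : v.1 = cs.simple i * u.1) : u ⋖ v :=
  MinRep.covBy (h ▸ BruhatLE.simple_mul hu) (h ▸ cs.not_isLeftDescent_iff.1 hu)

theorem MinRep.exists_isLeftDescent {w : MinRep cs J} (h : w.1 ≠ 1) :
    ∃ (i : B) (v : MinRep cs J), cs.IsLeftDescent w.1 i ∧ v.1 = cs.simple i * w.1 ∧ v ⋖ w := by
  obtain ⟨i, hi⟩ := cs.exists_leftDescent_of_ne_one h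
  refine ⟨i, (w.isMin.simple_mul hi).toMinRep, hi, rfl, ?_⟩
  exact MinRep.covBy_simple_mul (i := i) (cs.isLeftDescent_iff_not_isLeftDescent_mul.1 hi)
    (by simp [IsMin.toMinRep])

/-- Length is strictly monotone, and stripping left descents never leaves `W^J`, so a chain of
`ℓ(w)` steps ends at `w`. -/
theorem MinRep.height_eq (w : MinRep cs J) : Order.height w = cs.length w.1 := by
  apply le_antisymm
  · induction hn : cs.length w.1 using Nat.strong_induction_on generalizing w with
    | _ n ih =>
      rw [Order.height_eq_iSup_lt_height]
      refine iSup₂_le fun v hv => ?_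
      have h1 := MinRep.length_strictMono hv
      have h2 := ih _ (hn ▸ h1) v rfl
      calc Order.height v + 1 ≤ (cs.length v.1 : ℕ∞) + 1 := by gcongr
        _ ≤ n := by exact_mod_cast hn ▸ h1
  · induction hn : cs.length w.1 generalizing w with
    | zero => simp
    | succ n ih =>
      obtain ⟨i, v, hi, hv, hc⟩ := MinRep.exists_isLeftDescent (w := w) (by
        rintro h; rw [h, cs.length_one] at hn; omega)
      have h1 := cs.isLeftDescent_iff.1 hi
      rw [← hv] at h1
      have h2 := ih v (by omega)
      push_cast
      exact (by gcongr : (n : ℕ∞) + 1 ≤ Order.height v + 1).trans (Order.height_add_one_le hc.lt)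

theorem L_le {u v : MinRep cs J} {w : W} (hu : BruhatLE cs u.1 w) (hv : BruhatLE cs v.1 w) :
    L u v ≤ cs.length w := by
  obtain ⟨w', h1, h2, h3⟩ := exists_isMin_le (cs := cs) J w
  have hL : L u v ≤ Order.height h1.toMinRep :=
    iInf₂_le (f := fun (w : MinRep cs J) (_ : u ≤ w ∧ v ≤ w) => Order.height w)
      h1.toMinRep ⟨h3 _ u.isMin hu, h3 _ v.isMin hv⟩
  rw [MinRep.height_eq] at hL
  exact hL.trans (by exact_mod_cast h2.length_le)

theorem exists_L_eq (u v : MinRep cs J) :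
    ∃ w : W, BruhatLE cs u.1 w ∧ BruhatLE cs v.1 w ∧ L u v = cs.length w := by
  classical
  have hne : ∃ n, ∃ w : W, cs.length w = n ∧ BruhatLE cs u.1 w ∧ BruhatLE cs v.1 w := by
    obtain ⟨w, h1, h2⟩ := bruhat_directed (cs := cs) u.1 v.1
    exact ⟨_, w, rfl, h1, h2⟩
  obtain ⟨w, hw, h1, h2⟩ := Nat.find_spec hne
  refine ⟨w, h1, h2, le_antisymm (L_le h1 h2) (le_iInf₂ fun w' hw' => ?_)⟩
  rw [hw, MinRep.height_eq]
  exact_mod_cast Nat.find_min' hne ⟨w'.1, rfl, hw'.1, hw'.2⟩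

theorem isUniqueLowerCover_unique {P : Type*} [PartialOrder P] {x y w : P}
    (hx : IsUniqueLowerCover x w) (hy : IsUniqueLowerCover y w) : x = y := hy.2 x hx.1

end MinRep

/-! ### Words without braids -/

section Rigid

variable {B W : Type*} [Group W] {M : CoxeterMatrix B} {cs : CoxeterSystem M W} {J : Set B}

/-- The product `f (n-1) ⋯ f 1 f 0` of simple reflections. -/
def pathProd (cs : CoxeterSystem M W) (f : ℕ → B) (n : ℕ) : W := cs.wordProd (descWord f n)

theorem descWord_succ (f : ℕ → B) (n : ℕ) : descWord f (n + 1) = f n :: descWord f n := by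
  simp [descWord, List.range_succ]

theorem descWord_congr {f g : ℕ → B} {n : ℕ} (h : ∀ i < n, f i = g i) :
    descWord f n = descWord g n :=
  List.map_congr_left fun i hi => h i (by simpa using hi)

@[simp] theorem pathProd_zero (f : ℕ → B) : pathProd cs f 0 = 1 := by simp [pathProd, descWord]

theorem pathProd_succ (f : ℕ → B) (n : ℕ) :
    pathProd cs f (n + 1) = cs.simple (f n) * pathProd cs f n := by
  rw [pathProd, descWord_succ, cs.wordProd_cons]; rfl

theorem pathProd_congr {f g : ℕ → B} {n : ℕ} (h : ∀ i < n, f i = g i) :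
    pathProd cs f n = pathProd cs g n := by
  rw [pathProd, descWord_congr h]; rfl

/-- In the word `f (N-1) ⋯ f 0`, neighbours are distinct and there is no factor to which a braid
relation applies. -/
def Rigid (M : CoxeterMatrix B) (f : ℕ → B) (N : ℕ) : Prop :=
  ∀ i, i + 1 < N → f i ≠ f (i + 1) ∧
    (M (f i) (f (i + 1)) ≠ 0 → i + M (f i) (f (i + 1)) ≤ N →
      ∃ r, r + 2 < M (f i) (f (i + 1)) ∧ f (i + r) ≠ f (i + r + 2))

theorem Rigid.mono {f : ℕ → B} {N n : ℕ} (h : Rigid M f N) (hn : n ≤ N) : Rigid M f n :=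
  fun i hi => ⟨(h i (by omega)).1, fun h0 hle => (h i (by omega)).2 h0 (by omega)⟩

/-- When each partial product has its first letter as its only left descent, the letters of an
alternating prefix can be read off the word one at a time. -/
theorem eq_of_pathProd_eq_altProd_mul {f : ℕ → B} {n : ℕ}
    (H : ∀ k ≤ n, cs.length (pathProd cs f k) = k ∧
      ∀ c, cs.IsLeftDescent (pathProd cs f k) c → ∃ l, k = l + 1 ∧ c = f l)
    {a c : B} {q : ℕ} {y : W} (e : pathProd cs f n = altProd cs a c q * y)
    (hl : cs.length (pathProd cs f n) = q + cs.length y) :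
    q ≤ n ∧ ∀ r < q, ∀ i, i + r + 1 = n → f i = if Even r then a else c := by
  induction q generalizing a c n with
  | zero => simp
  | succ q ih =>
    have h1 : cs.simple a * pathProd cs f n = altProd cs c a q * y := by
      rw [e, altProd, mul_assoc, cs.simple_mul_simple_cancel_left]
    obtain ⟨ω, hω, e2, -⟩ := altProd_eq_wordProd (cs := cs) c a q
    have h2 : cs.length (altProd cs c a q * y) ≤ q + cs.length y := by
      refine (cs.length_mul_le _ _).trans ?_
      rw [e2]
      have := cs.length_wordProd_le ω
      omega
    have hd : cs.IsLeftDescent (pathProd cs f n) a := by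
      rw [CoxeterSystem.IsLeftDescent, h1]; omega
    obtain ⟨l, rfl, rfl⟩ := (H n le_rfl).2 a hd
    rw [pathProd_succ, cs.simple_mul_simple_cancel_left] at h1
    have h3 := (H l (by omega)).1
    have h4 := (H (l + 1) le_rfl).1
    obtain ⟨h5, h6⟩ := ih (fun k hk => H k (by omega)) h1 (by omega)
    refine ⟨by omega, fun r hr i hi => ?_⟩
    cases r with
    | zero =>
      obtain rfl : i = l := by omega
      simp
    | succ r =>
      rw [h6 r (by omega) i (by omega)]
      by_cases hr : Even r <;> simp [hr, Nat.even_add_one]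

/-- A second left descent `c` of `f n ⋯ f 0` makes the product begin with the longest alternating
product in `f n` and `c`. By induction the word itself then begins with these `m` letters, a braid
that rigidity excludes. -/
theorem Rigid.length_and_isLeftDescent {f : ℕ → B} {N : ℕ} (h : Rigid M f N) :
    ∀ n ≤ N, cs.length (pathProd cs f n) = n ∧
      ∀ c, cs.IsLeftDescent (pathProd cs f n) c → ∃ l, n = l + 1 ∧ c = f l := by
  intro n
  induction n using Nat.strong_induction_on with
  | _ n ih =>
    intro hn
    cases n with
    | zero => exact ⟨by simp, fun c hc => absurd hc (by simp [cs.not_isLeftDescent_one])⟩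
    | succ n =>
      obtain ⟨h1, h2⟩ := ih n (by omega) (by omega)
      have hnot : ¬cs.IsLeftDescent (pathProd cs f n) (f n) := by
        intro hd
        obtain ⟨l, rfl, e⟩ := h2 _ hd
        exact (h l (by omega)).1 e.symm
      have hlen : cs.length (pathProd cs f (n + 1)) = n + 1 := by
        rw [pathProd_succ, cs.not_isLeftDescent_iff.1 hnot, h1]
      refine ⟨hlen, fun c hc => ⟨n, rfl, ?_⟩⟩
      by_contra hcn
      have ha : cs.IsLeftDescent (pathProd cs f (n + 1)) (f n) := by
        rw [pathProd_succ, cs.isLeftDescent_iff_not_isLeftDescent_mul]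
        simpa using hnot
      obtain ⟨h0, y, e, hl⟩ := two_leftDescents (Ne.symm hcn) ha hc
      have hM1 : M (f n) c ≠ 1 := M.off_diagonal _ _ (Ne.symm hcn)
      obtain ⟨q, hq⟩ : ∃ q, M (f n) c = q + 2 := ⟨M (f n) c - 2, by omega⟩
      rw [hq, altProd, pathProd_succ, mul_assoc, mul_right_inj] at e
      obtain ⟨h3, h4⟩ := eq_of_pathProd_eq_altProd_mul
        (fun k hk => ih k (by omega) (by omega)) e (by omega)
      have h5 : ∀ r < q + 2, ∀ i, i + r = n → f i = if Even r then f n else c := by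
        intro r hr i hi
        cases r with
        | zero =>
          obtain rfl : i = n := by omega
          simp
        | succ r =>
          rw [h4 r (by omega) i (by omega)]
          by_cases hr : Even r <;> simp [hr, Nat.even_add_one]
      obtain ⟨i, rfl⟩ : ∃ i, n = i + (q + 1) := ⟨n - (q + 1), by omega⟩
      have h6 := h i (by omega)
      have hMi : M (f i) (f (i + 1)) = q + 2 := by
        rw [h5 (q + 1) (by omega) i (by omega), h5 q (by omega) (i + 1) (by omega)]
        by_cases hq' : Even q
        · simp only [Nat.even_add_one, hq', not_true_eq_false, if_true, if_false]
          rw [M.symmetric, hq]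
        · simp only [Nat.even_add_one, hq', not_false_eq_true, if_true, if_false, hq]
      rw [hMi] at h6
      obtain ⟨r, hr, hne⟩ := h6.2 (by omega) (by omega)
      apply hne
      -- Counted from the left end, positions `i + r` and `i + r + 2` are `s + 2` and `s`; equal
      -- parity gives equal letters.
      obtain ⟨s, hs⟩ : ∃ s, q + 1 = r + 2 + s := ⟨q + 1 - (r + 2), by omega⟩
      rw [h5 (s + 2) (by omega) (i + r) (by omega), h5 s (by omega) (i + r + 2) (by omega)]
      simp [Nat.even_add]

theorem Rigid.length {f : ℕ → B} {n : ℕ} (h : Rigid M f n) : cs.length (pathProd cs f n) = n :=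
  (h.length_and_isLeftDescent n le_rfl).1

theorem Rigid.eq_of_isLeftDescent {f : ℕ → B} {n : ℕ} (h : Rigid M f n) {c : B}
    (hc : cs.IsLeftDescent (pathProd cs f n) c) : ∃ l, n = l + 1 ∧ c = f l :=
  (h.length_and_isLeftDescent n le_rfl).2 c hc

theorem Rigid.isLeftDescent {f : ℕ → B} {n : ℕ} (h : Rigid M f (n + 1)) :
    cs.IsLeftDescent (pathProd cs f (n + 1)) (f n) := by
  rw [CoxeterSystem.IsLeftDescent, h.length, pathProd_succ, cs.simple_mul_simple_cancel_left,
    (h.mono (Nat.le_succ n)).length]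
  exact Nat.lt_succ_self n

theorem Rigid.not_isLeftDescent {f : ℕ → B} {n : ℕ} (h : Rigid M f (n + 1)) :
    ¬cs.IsLeftDescent (pathProd cs f n) (f n) := by
  rw [CoxeterSystem.IsLeftDescent, ← pathProd_succ, h.length, (h.mono (Nat.le_succ n)).length]
  omega

/-- If `j` first becomes a right descent when a letter `s` is put in front of `z`, then `s z = z
s_j`. So for `z ≠ 1` the product also begins with the first letter of `z`, which is a second left
descent. -/
theorem Rigid.eq_of_isRightDescent {f : ℕ → B} {n : ℕ} (h : Rigid M f n) {j : B}
    (hj : cs.IsRightDescent (pathProd cs f n) j) : j = f 0 := by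
  induction n with
  | zero => exact absurd hj (by simp [cs.not_isRightDescent_one])
  | succ n ih =>
    have h' := h.mono (Nat.le_succ n)
    by_cases hj' : cs.IsRightDescent (pathProd cs f n) j
    · exact ih h' hj'
    rw [pathProd_succ] at hj
    have e := simple_mul_eq_mul_simple hj' hj
    cases n with
    | zero => simpa using (simple_injective cs (by simpa using e)).symm
    | succ n =>
      exfalso
      have h2 : cs.IsLeftDescent (pathProd cs f (n + 2)) (f n) := by
        rw [CoxeterSystem.IsLeftDescent, h.length, pathProd_succ f (n + 1), e, ← mul_assoc,
          pathProd_succ f n, cs.simple_mul_simple_cancel_left]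
        have := cs.length_mul_le (pathProd cs f n) (cs.simple j)
        rw [(h'.mono (Nat.le_succ n)).length, cs.length_simple] at this
        omega
      obtain ⟨l, hl, e'⟩ := h.eq_of_isLeftDescent h2
      obtain rfl : n + 1 = l := by omega
      exact (h n (by omega)).1 e'

theorem Rigid.isMin {f : ℕ → B} {n : ℕ} (h : Rigid M f n) (h0 : f 0 ∉ J) :
    IsMin cs J (pathProd cs f n) := by
  rintro j hj hd
  exact h0 (h.eq_of_isRightDescent hd ▸ hj)

theorem Rigid.eq_of_pathProd_eq {f g : ℕ → B} {n k : ℕ} (hf : Rigid M f n) (hg : Rigid M g k)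
    (e : pathProd cs f n = pathProd cs g k) : n = k ∧ ∀ i < n, f i = g i := by
  have h1 := hf.length (cs := cs)
  rw [e, hg.length] at h1
  subst h1
  refine ⟨rfl, ?_⟩
  induction k with
  | zero => simp
  | succ k ih =>
    have hd := hf.isLeftDescent (cs := cs)
    rw [e] at hd
    obtain ⟨l, hl, e'⟩ := hg.eq_of_isLeftDescent hd
    obtain rfl : k = l := by omega
    rw [pathProd_succ, pathProd_succ, e', mul_right_inj] at e
    intro i hi
    rcases Nat.lt_succ_iff_lt_or_eq.1 hi with hi | rfl
    · exact ih (hg.mono (Nat.le_succ _)) (hf.mono (Nat.le_succ _)) e i hi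
    · exact e'

theorem Rigid.pathProd_le {f : ℕ → B} {n k : ℕ} (h : Rigid M f n) (hk : k ≤ n) :
    BruhatLE cs (pathProd cs f k) (pathProd cs f n) := by
  induction n, hk using Nat.le_induction with
  | base => exact .refl _
  | succ n hn ih =>
    refine (ih (h.mono (Nat.le_succ n))).trans ?_
    rw [pathProd_succ]
    exact .simple_mul h.not_isLeftDescent

/-- The element of `W^J` given by a rigid word. -/
def Rigid.toMinRep (cs : CoxeterSystem M W) {f : ℕ → B} {n : ℕ} (h : Rigid M f n) (h0 : f 0 ∉ J) :
    MinRep cs J := (h.isMin h0).toMinRep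

/-! ### Lower sets that are chains -/

/-- A condition on a rigid word which forces the lower set in `W^J` of its product to be a
chain. -/
def ChainCond (M : CoxeterMatrix B) (J : Set B) (f : ℕ → B) (N : ℕ) : Prop :=
  ∀ n < N, ∀ j < n, f n = f j ∨ (1 ≤ j ∧ f n = f (j - 1)) ∨
    (f n ∈ J ∧ ∀ i < j, M (f i) (f n) = 2)

theorem simple_commute {s t : B} (h : M s t = 2) : Commute (cs.simple s) (cs.simple t) := by
  have h1 := cs.simple_mul_simple_pow s t
  rw [h, pow_two] at h1
  have h2 := eq_inv_of_mul_eq_one_left h1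
  rwa [mul_inv_rev, cs.inv_simple, cs.inv_simple] at h2

theorem pathProd_commute {f : ℕ → B} {j : ℕ} {b : B} (h : ∀ i < j, M (f i) b = 2) :
    Commute (pathProd cs f j) (cs.simple b) := by
  induction j with
  | zero => simp
  | succ j ih =>
    rw [pathProd_succ]
    exact (simple_commute (h j (by omega))).mul_left (ih fun i hi => h i (by omega))

/-- If the top letter `b` is not a left descent of `y`, then `y` lies below the shorter word.
Otherwise `s_b y` is a partial product of some length `j`. If `j` is not maximal, `ChainCond` leaves
three cases: `b` continues the partial product, or it is already its left descent (impossible), or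
it commutes to the right end of `y` and contradicts minimality. -/
theorem eq_pathProd_of_le {f : ℕ → B} {N : ℕ} (hr : Rigid M f N) (hc : ChainCond M J f N)
    {n : ℕ} (hn : n ≤ N) {y : W} (hy : IsMin cs J y) (hle : BruhatLE cs y (pathProd cs f n)) :
    ∃ j ≤ n, y = pathProd cs f j := by
  induction n generalizing y with
  | zero =>
    refine ⟨0, le_rfl, hle.eq_of_length_le ?_⟩
    simp
  | succ n ih =>
    by_cases hd : cs.IsLeftDescent y (f n)
    · have h1 := hle.simple_mul_le_simple_mul hd
      rw [pathProd_succ, cs.simple_mul_simple_cancel_left] at h1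
      obtain ⟨j, hj, e⟩ := ih (by omega) (hy.simple_mul hd) h1
      have e' : y = cs.simple (f n) * pathProd cs f j := by rw [← e]; simp
      have hnd : ¬cs.IsLeftDescent (pathProd cs f j) (f n) := by
        rw [← e]; exact cs.isLeftDescent_iff_not_isLeftDescent_mul.1 hd
      rcases hj.eq_or_lt with rfl | hj
      · exact ⟨j + 1, le_rfl, by rw [e', pathProd_succ]⟩
      rcases hc n (by omega) j hj with h2 | ⟨h2, h3⟩ | ⟨h2, h3⟩
      · exact ⟨j + 1, by omega, by rw [e', pathProd_succ, h2]⟩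
      · obtain ⟨l, rfl⟩ : ∃ l, j = l + 1 := ⟨j - 1, by omega⟩
        rw [Nat.add_sub_cancel] at h3
        rw [h3] at hnd
        exact absurd (hr.mono (by omega)).isLeftDescent hnd
      · exfalso
        apply hy _ h2
        rw [← (pathProd_commute h3).eq] at e'
        rw [cs.isLeftDescent_iff, e] at hd
        rw [cs.isRightDescent_iff, e', cs.simple_mul_simple_cancel_right, ← e']
        exact hd
    · have h1 := hle.le_simple_mul_of_not_isLeftDescent
        (hr.mono hn).isLeftDescent hd
      rw [pathProd_succ, cs.simple_mul_simple_cancel_left] at h1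
      obtain ⟨j, hj, e⟩ := ih (by omega) hy h1
      exact ⟨j, by omega, e⟩

theorem isUniqueLowerCover_of_chainCond {f : ℕ → B} {n : ℕ} (hr : Rigid M f (n + 1))
    (hc : ChainCond M J f (n + 1)) {x w : MinRep cs J}
    (hx : x.1 = pathProd cs f n) (hw : w.1 = pathProd cs f (n + 1)) : IsUniqueLowerCover x w := by
  refine ⟨MinRep.covBy_simple_mul (i := f n) (hx ▸ hr.not_isLeftDescent)
    (by rw [hw, hx, pathProd_succ]), fun y hy => ?_⟩
  have h1 : BruhatLE cs y.1 w.1 := hy.le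
  rw [hw] at h1
  obtain ⟨j, hj, e⟩ := eq_pathProd_of_le hr hc le_rfl y.isMin h1
  have hj' : j ≠ n + 1 := by
    rintro rfl
    exact hy.ne (Subtype.ext (e.trans hw.symm))
  have hyx : y ≤ x := by
    change BruhatLE cs y.1 x.1
    rw [e, hx]
    exact (hr.mono (Nat.le_succ n)).pathProd_le (by omega)
  have hxw : x < w := (MinRep.covBy_simple_mul (i := f n) (hx ▸ hr.not_isLeftDescent)
    (by rw [hw, hx, pathProd_succ])).lt
  by_contra hne
  exact hy.2 (lt_of_le_of_ne hyx hne) hxw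

theorem MinRep.isBot {x : MinRep cs J} (hx : x.1 = 1) : IsBot x := by
  intro y
  change BruhatLE cs x.1 y.1
  rw [hx]
  exact one_bruhatLE _

theorem chainlike_of_chainCond {f : ℕ → B} {n : ℕ} (hr : Rigid M f (n + 1))
    (hc : ChainCond M J f (n + 1)) (h0 : f 0 ∉ J) {w : MinRep cs J}
    (hw : w.1 = pathProd cs f (n + 1)) : Chainlike w := by
  induction n generalizing w with
  | zero =>
    have hr' := hr.mono (Nat.le_succ 0)
    exact .of_bot (isUniqueLowerCover_of_chainCond hr hc (x := hr'.toMinRep cs h0) rfl hw)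
      (MinRep.isBot (by simp [Rigid.toMinRep, IsMin.toMinRep]))
  | succ n ih =>
    have hr' := hr.mono (Nat.le_succ (n + 1))
    refine .of_chainlike (isUniqueLowerCover_of_chainCond hr hc (x := hr'.toMinRep cs h0) rfl hw)
      (ih hr' (fun k hk => hc k (by omega)) rfl)

end Rigid

/-! ### Simple expressions and the words of the three forms -/

section Forms

variable {B W : Type*} [Group W] {M : CoxeterMatrix B} {cs : CoxeterSystem M W} {J : Set B}

theorem natCast_le_m {s t : B} (n : ℕ) : (n : ℕ∞) ≤ m M s t ↔ M s t = 0 ∨ n ≤ M s t := by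
  unfold m
  split_ifs with h
  · simp [h]
  · simp [h]

theorem natCast_lt_m {s t : B} (n : ℕ) : (n : ℕ∞) < m M s t ↔ M s t = 0 ∨ n < M s t := by
  unfold m
  split_ifs with h
  · simp [h]
  · simp [h]

theorem three_le_m {s t : B} : 3 ≤ m M s t ↔ M s t = 0 ∨ 3 ≤ M s t := natCast_le_m 3

theorem four_le_m {s t : B} : 4 ≤ m M s t ↔ M s t = 0 ∨ 4 ≤ M s t := natCast_le_m 4

theorem eq_two_of_not_three_le_m {s t : B} (hst : s ≠ t) (h : ¬3 ≤ m M s t) : M s t = 2 := by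
  rw [three_le_m] at h
  have := M.off_diagonal s t hst
  omega

theorem IsSimpleSeq.mono {k l : ℕ} {s : ℕ → B} (h : IsSimpleSeq M J k s) (hl : l ≤ k) :
    IsSimpleSeq M J l s :=
  ⟨fun i hi j hj => h.1 i (by omega) j (by omega), h.2.1,
    fun i hi hi' => h.2.2.1 i hi (by omega), fun i hi j hj => h.2.2.2 i (by omega) j (by omega)⟩

theorem IsSimpleSeq.ne {k : ℕ} {s : ℕ → B} (h : IsSimpleSeq M J k s) {i j : ℕ} (hi : i ≤ k)
    (hj : j ≤ k) (hij : i ≠ j) : s i ≠ s j := fun e => hij (h.1 i hi j hj e)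

theorem IsSimpleSeq.eq_two {k : ℕ} {s : ℕ → B} (h : IsSimpleSeq M J k s) {i j : ℕ}
    (hj : j ≤ k) (hij : i + 1 < j) : M (s i) (s j) = 2 := by
  refine eq_two_of_not_three_le_m (h.ne (by omega) hj (by omega)) fun h3 => ?_
  have := (h.2.2.2 i (by omega) j hj).1 h3
  omega

theorem IsSimpleSeq.three_le {k : ℕ} {s : ℕ → B} (h : IsSimpleSeq M J k s) {i : ℕ}
    (hi : i + 1 ≤ k) : M (s i) (s (i + 1)) = 0 ∨ 3 ≤ M (s i) (s (i + 1)) :=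
  three_le_m.1 ((h.2.2.2 i (by omega) (i + 1) hi).2 (Or.inl rfl))

theorem IsSimpleSeq.rigid {k : ℕ} {s : ℕ → B} (h : IsSimpleSeq M J k s) :
    Rigid M s (k + 1) := by
  intro i hi
  have h3 := h.three_le (i := i) (by omega)
  exact ⟨h.ne (by omega) (by omega) (by omega), fun h0 hle =>
    ⟨0, by omega, h.ne (by omega) (by omega) (by omega)⟩⟩

theorem IsSimpleSeq.chainCond {k : ℕ} {s : ℕ → B} (h : IsSimpleSeq M J k s) :
    ChainCond M J s (k + 1) := by
  intro n hn j hj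
  exact Or.inr (Or.inr ⟨h.2.2.1 n (by omega) (by omega), fun i hi => h.eq_two (by omega)
    (by omega)⟩)

/-- The sequence `s 0, …, s (n-1), s n, b, s n, b, …`. -/
def extSeq (s : ℕ → B) (n : ℕ) (b : B) (i : ℕ) : B :=
  if i < n then s i else if Even (i - n) then s n else b

theorem extSeq_of_le {s : ℕ → B} {n : ℕ} {b : B} {i : ℕ} (h : i ≤ n) : extSeq s n b i = s i := by
  unfold extSeq
  split_ifs with h1 h2
  · rfl
  · rw [show i = n by omega]
  · exact absurd (by simp [Nat.sub_eq_zero_of_le h]) h2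

theorem extSeq_of_le' {s : ℕ → B} {n i : ℕ} (h : i ≤ n + 1) :
    extSeq s n (s (n + 1)) i = s i := by
  rcases Nat.lt_or_ge n i with h1 | h1
  · obtain rfl : i = n + 1 := by omega
    simp [extSeq]
  · exact extSeq_of_le h1

theorem extSeq_add (s : ℕ → B) (n : ℕ) (b : B) (r : ℕ) :
    extSeq s n b (n + r) = if Even r then s n else b := by
  simp [extSeq]

/-- Below position `n` letters two apart differ, and the alternating tail is too short for a braid.
The letter `b` is kept general: it is `s (n + 1)` for form (III) and the competing end letter for a
fork. -/
theorem rigid_extSeq {n N : ℕ} {s : ℕ → B} {b : B} (h : IsSimpleSeq M J n s)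
    (hb : ∀ i ≤ n, s i ≠ b) (hN : M (s n) b ≠ 0 → N < n + M (s n) b) :
    Rigid M (extSeq s n b) N := by
  intro i hi
  rcases Nat.lt_or_ge i n with h1 | h1
  · rw [extSeq_of_le h1.le, extSeq_of_le (i := i + 1) h1]
    refine ⟨h.ne h1.le h1 (by omega), fun h0 hle => ⟨0, ?_, ?_⟩⟩
    · have := h.three_le (i := i) h1
      omega
    · rw [add_zero, extSeq_of_le h1.le]
      rcases Nat.lt_or_ge (i + 1) n with h2 | h2
      · rw [extSeq_of_le (i := i + 2) h2]
        exact h.ne (by omega) (by omega) (by omega)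
      · rw [show i + 2 = n + 1 by omega, extSeq_add]
        simpa using hb i h1.le
  · obtain ⟨r, rfl⟩ := Nat.exists_eq_add_of_le h1
    rw [add_assoc n r 1, extSeq_add, extSeq_add]
    by_cases hr : Even r
    · simp only [Nat.even_add_one, hr, not_true_eq_false, if_true, if_false]
      exact ⟨hb n le_rfl, fun h0 hle => absurd (hN h0) (by omega)⟩
    · simp only [Nat.even_add_one, hr, not_false_eq_true, if_true, if_false]
      rw [M.symmetric b]
      exact ⟨(hb n le_rfl).symm, fun h0 hle => absurd (hN h0) (by omega)⟩

theorem chainCond_extSeq {n N : ℕ} {s : ℕ → B} (h : IsSimpleSeq M J (n + 1) s) :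
    ChainCond M J (extSeq s n (s (n + 1))) N := by
  intro q hq j hj
  rcases Nat.lt_or_ge (n + 1) q with h1 | h1
  · obtain ⟨r, rfl⟩ := Nat.exists_eq_add_of_le (show n ≤ q by omega)
    rcases Nat.lt_or_ge j n with h2 | h2
    · right; right
      have key : ∀ i, i ≤ n + 1 → j < i → s i ∈ J ∧
          ∀ i' < j, M (extSeq s n (s (n + 1)) i') (s i) = 2 := fun i hi hji =>
        ⟨h.2.2.1 i (by omega) hi, fun i' hi' => by
          rw [extSeq_of_le (by omega)]
          exact h.eq_two hi (by omega)⟩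
      rw [extSeq_add]
      split_ifs
      · exact key n (by omega) h2
      · exact key (n + 1) le_rfl (by omega)
    · obtain ⟨t, rfl⟩ := Nat.exists_eq_add_of_le h2
      rw [extSeq_add, extSeq_add]
      by_cases hp : Even r ↔ Even t
      · left
        simp [hp]
      · cases t with
        -- Here `j = n` has no predecessor in the tail, but the letter `s (n + 1)` commutes with all
        -- `s i`, `i < n`.
        | zero =>
          simp only [Even.zero, iff_true] at hp
          right; right
          rw [if_neg hp]
          refine ⟨h.2.2.1 _ (by omega) le_rfl, fun i hi => ?_⟩
          rw [extSeq_of_le (by omega)]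
          exact h.eq_two le_rfl (by omega)
        | succ t =>
          right; left
          refine ⟨by omega, ?_⟩
          rw [show n + (t + 1) - 1 = n + t by omega, extSeq_add]
          have : Even r ↔ Even t := by
            rw [Nat.even_add_one] at hp
            tauto
          simp [this]
  · right; right
    rw [extSeq_of_le' h1]
    refine ⟨h.2.2.1 q (by omega) h1, fun i hi => ?_⟩
    rw [extSeq_of_le' (by omega)]
    exact h.eq_two h1 (by omega)

theorem descWord_extSeq (s : ℕ → B) (n : ℕ) (b : B) (p : ℕ) :
    descWord (extSeq s n b) (n + p) =
      CoxeterSystem.alternatingWord b (s n) p ++ descWord s n := by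
  induction p with
  | zero =>
    rw [add_zero, CoxeterSystem.alternatingWord, List.nil_append]
    exact descWord_congr fun i hi => extSeq_of_le hi.le
  | succ p ih =>
    rw [← add_assoc, descWord_succ, ih, extSeq_add, CoxeterSystem.alternatingWord_succ',
      List.cons_append]

/-- The sequence `s 0, …, s (k-1), s k, s (k-1), …`. -/
def foldSeq (s : ℕ → B) (k : ℕ) (i : ℕ) : B := if i ≤ k then s i else s (2 * k - i)

theorem descWord_foldSeq (s : ℕ → B) (l d : ℕ) :
    descWord (foldSeq s (l + d)) (l + d + 1 + d) =
      ascWord s l (l + d) ++ descWord s (l + d + 1) := by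
  suffices ∀ d' l', l' + d' = l + d → descWord (foldSeq s (l + d)) (l + d + 1 + d') =
      ascWord s l' (l + d) ++ descWord s (l + d + 1) from this d l rfl
  intro d'
  induction d' with
  | zero =>
    rintro l' hl'
    rw [← hl', ascWord]
    simp only [add_zero, Nat.sub_self, List.range'_zero, List.map_nil, List.nil_append]
    refine descWord_congr fun i hi => ?_
    rw [foldSeq, if_pos (by omega)]
  | succ d' ih =>
    intro l' hl'
    rw [← add_assoc, descWord_succ, ih (l' + 1) (by omega), foldSeq, if_neg (by omega), ascWord,
      ascWord, show l + d - l' = (l + d - (l' + 1)) + 1 by omega, List.range'_succ, List.map_cons,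
      List.cons_append]
    congr 2
    omega

theorem rigid_foldSeq {k N : ℕ} {s : ℕ → B} (h : IsSimpleSeq M J (k + 1) s)
    (h4 : 4 ≤ m M (s (k + 1)) (s k)) (hN : N ≤ 2 * (k + 1) + 1) :
    Rigid M (foldSeq s (k + 1)) N := by
  intro i hi
  unfold foldSeq
  rcases Nat.lt_or_ge i (k + 1) with h1 | h1
  · rw [if_pos (by omega), if_pos (by omega)]
    refine ⟨h.ne (by omega) (by omega) (by omega), fun h0 hle => ?_⟩
    have h3 := h.three_le (i := i) h1
    rcases Nat.lt_or_ge i k with h2 | h2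
    · refine ⟨0, by omega, ?_⟩
      rw [if_pos (by omega), if_pos (by omega)]
      exact h.ne (by omega) (by omega) (by omega)
    · obtain rfl : i = k := by omega
      rw [m_comm, four_le_m] at h4
      -- The fold is the only place where letters two apart agree, so `r = 0` fails. As `m ≥ 4`, a
      -- braid starting here would need a fourth letter `s (k + 1)`, which the folded word does not
      -- have.
      refine ⟨1, by omega, ?_⟩
      rw [if_pos (by omega), if_neg (by omega)]
      exact h.ne (by omega) (by omega) (by omega)
  · have e : (if i ≤ k + 1 then s i else s (2 * (k + 1) - i)) = s (2 * (k + 1) - i) := by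
      split_ifs with h2
      · rw [show 2 * (k + 1) - i = i by omega]
      · rfl
    rw [e, if_neg (by omega)]
    obtain ⟨j, hj⟩ : ∃ j, 2 * (k + 1) - i = j + 1 := ⟨2 * (k + 1) - i - 1, by omega⟩
    rw [hj, show 2 * (k + 1) - (i + 1) = j by omega, M.symmetric]
    have h3 := h.three_le (i := j) (by omega)
    refine ⟨h.ne (by omega) (by omega) (by omega), fun h0 hle => ⟨0, by omega, ?_⟩⟩
    rw [add_zero, e, if_neg (by omega), hj]
    exact h.ne (by omega) (by omega) (by omega)

end Forms

/-! ### The relation `∼` on form (I) elements -/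

section Sim

variable {B W : Type*} [Group W] {M : CoxeterMatrix B} {cs : CoxeterSystem M W} {J : Set B}

theorem mem_chainForms_I {w : MinRep cs J} : w ∈ chainForms cs J .I ↔
    ∃ (k : ℕ) (s : ℕ → B), IsSimpleSeq M J k s ∧ w.1 = pathProd cs s (k + 1) := by
  constructor
  · rintro ⟨-, h⟩
    exact h
  · rintro ⟨k, s, hs, hw⟩
    exact ⟨chainlike_of_chainCond hs.rigid hs.chainCond hs.2.1 hw, k, s, hs, hw⟩

theorem IsSimpleSeq.exists_isUniqueLowerCover {k : ℕ} {s : ℕ → B} (hs : IsSimpleSeq M J k s)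
    {w : MinRep cs J} (hw : w.1 = pathProd cs s (k + 1)) :
    ∃ x : MinRep cs J, x.1 = pathProd cs s k ∧ IsUniqueLowerCover x w :=
  ⟨(hs.rigid.mono (Nat.le_succ k)).toMinRep cs hs.2.1, rfl,
    isUniqueLowerCover_of_chainCond hs.rigid hs.chainCond rfl hw⟩

theorem IsSimpleSeq.eq_of_isUniqueLowerCover {k : ℕ} {s : ℕ → B} (hs : IsSimpleSeq M J k s)
    {x w : MinRep cs J} (hw : w.1 = pathProd cs s (k + 1)) (hx : IsUniqueLowerCover x w) :
    x.1 = pathProd cs s k := by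
  obtain ⟨y, hy, hyw⟩ := hs.exists_isUniqueLowerCover hw
  rw [isUniqueLowerCover_unique hx hyw, hy]

/-- Take a left descent `c` of `w`. If `c` is the common end letter `t l`, then `s_c w` works: `c`
is no descent of the first path since `j ≤ k`. Otherwise `c` is stripped from `w`, and from the
first path if it is a descent there; induction applies, and a stripped letter is put back with `up`.
This is why `j` varies. -/
theorem exists_shorter_upper_bound {k l : ℕ} {s t : ℕ → B} (hs : IsSimpleSeq M J k s)
    (ht : IsSimpleSeq M J l t) (hst : s k = t l) (w : W) {j : ℕ} (hj : j ≤ k)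
    (h1 : BruhatLE cs (pathProd cs s j) w) (h2 : BruhatLE cs (pathProd cs t (l + 1)) w) :
    ∃ w', cs.length w' + 1 ≤ cs.length w ∧ BruhatLE cs (pathProd cs s j) w' ∧
      BruhatLE cs (pathProd cs t l) w' := by
  induction hn : cs.length w using Nat.strong_induction_on generalizing w j with
  | _ n ih =>
    have hl := h2.length_le
    rw [ht.rigid.length] at hl
    obtain ⟨c, hc⟩ := cs.exists_leftDescent_of_ne_one (w := w) (by
      rintro rfl; simp at hl)
    have hc' := cs.isLeftDescent_iff.1 hc
    have hrs := hs.rigid.mono (show j ≤ k + 1 by omega)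
    by_cases hct : c = t l
    · subst hct
      refine ⟨cs.simple (t l) * w, by omega, h1.le_simple_mul_of_not_isLeftDescent hc ?_, ?_⟩
      · intro hd
        obtain ⟨i, rfl, e⟩ := hrs.eq_of_isLeftDescent hd
        exact hs.ne (i := k) le_rfl (by omega) (by omega) (hst.trans e)
      · have := h2.simple_mul_le_simple_mul ht.rigid.isLeftDescent
        rwa [pathProd_succ, cs.simple_mul_simple_cancel_left] at this
    · have h3 : BruhatLE cs (pathProd cs t (l + 1)) (cs.simple c * w) := by
        refine h2.le_simple_mul_of_not_isLeftDescent hc fun hd => hct ?_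
        obtain ⟨i, hi, e⟩ := ht.rigid.eq_of_isLeftDescent hd
        obtain rfl : l = i := by omega
        exact e
      by_cases hcs : cs.IsLeftDescent (pathProd cs s j) c
      · obtain ⟨i, rfl, rfl⟩ := hrs.eq_of_isLeftDescent hcs
        have h4 := h1.simple_mul_le_simple_mul hcs
        rw [pathProd_succ, cs.simple_mul_simple_cancel_left] at h4
        obtain ⟨w', h5, h6, h7⟩ := ih _ (by omega) _ (j := i) (by omega) h4 h3 rfl
        have h8 := length_up_le (cs := cs) (s i) w'
        refine ⟨up cs (s i) w', by omega, ?_, h7.trans (le_up _ _)⟩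
        have h9 := h6.up (s i)
        rw [pathProd_succ]
        exact (simple_mul_le_up _ _).trans h9
      · obtain ⟨w', h5, h6, h7⟩ := ih _ (by omega) _ hj
          (h1.le_simple_mul_of_not_isLeftDescent hc hcs) h3 rfl
        exact ⟨w', by omega, h6, h7⟩

theorem L_comm {P : Type*} [PartialOrder P] (u v : P) : L u v = L v u := by
  simp only [L, and_comm]

theorem L_mono {P : Type*} [PartialOrder P] {u u' : P} (h : u' ≤ u) (v : P) : L u' v ≤ L u v :=
  le_iInf₂ fun w hw => iInf₂_le (f := fun (w : P) (_ : u' ≤ w ∧ v ≤ w) => Order.height w) w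
    ⟨h.trans hw.1, hw.2⟩

/-- A shortest bound of `u'` and `v` shrinks by one to a bound of `u'` and `v'`; lifting it by the
common end letter gives a bound of `u` and `v` without exceeding the original length. -/
theorem L_eq_of_top_eq {k l : ℕ} {s t : ℕ → B} (hs : IsSimpleSeq M J k s)
    (ht : IsSimpleSeq M J l t) (hst : s k = t l) {u u' v : MinRep cs J}
    (hu : u.1 = pathProd cs s (k + 1)) (hv : v.1 = pathProd cs t (l + 1))
    (hu' : u'.1 = pathProd cs s k) : L u v = L u' v := by
  apply le_antisymm
  · obtain ⟨w, h1, h2, e⟩ := exists_L_eq u' v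
    rw [hu'] at h1
    rw [hv] at h2
    obtain ⟨w', h3, h4, h5⟩ := exists_shorter_upper_bound hs ht hst w le_rfl h1 h2
    rw [e]
    have h6 := length_up_le (cs := cs) (t l) w'
    refine (L_le (w := up cs (t l) w') ?_ ?_).trans (by exact_mod_cast (by omega))
    · rw [hu, pathProd_succ, hst]
      exact (simple_mul_le_up _ _).trans (h4.up _)
    · rw [hv, pathProd_succ]
      exact (simple_mul_le_up _ _).trans (h5.up _)
  · apply L_mono
    change BruhatLE cs u'.1 u.1
    rw [hu, hu']
    exact hs.rigid.pathProd_le (Nat.le_succ k)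

/-- Let `c` be a left descent of a shortest bound `w` of `u` and `v`. If the end letters differ, `c`
is a descent of at most one of them, so `s_c w` bounds `u', v` or `u, v'` or even `u, v`, making one
of the three values of `L` too small. -/
theorem top_eq_of_sim {k l : ℕ} {s t : ℕ → B} (hs : IsSimpleSeq M J k s)
    (ht : IsSimpleSeq M J l t) {u v : MinRep cs J}
    (hu : u.1 = pathProd cs s (k + 1)) (hv : v.1 = pathProd cs t (l + 1)) (h : Sim u v) :
    s k = t l := by
  obtain ⟨u', v', hu', hv', e1, e2⟩ := h
  have hu'' := hs.eq_of_isUniqueLowerCover hu hu'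
  have hv'' := ht.eq_of_isUniqueLowerCover hv hv'
  by_contra hne
  obtain ⟨w, h1, h2, e⟩ := exists_L_eq u v
  have hl := h1.length_le
  rw [hu, hs.rigid.length] at hl
  obtain ⟨c, hc⟩ := cs.exists_leftDescent_of_ne_one (w := w) (by
    rintro rfl; simp at hl)
  have hc' := cs.isLeftDescent_iff.1 hc
  have h3 : cs.IsLeftDescent u.1 c → c = s k := by
    intro hd
    rw [hu] at hd
    obtain ⟨i, hi, e⟩ := hs.rigid.eq_of_isLeftDescent hd
    obtain rfl : k = i := by omega
    exact e
  have h4 : cs.IsLeftDescent v.1 c → c = t l := by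
    intro hd
    rw [hv] at hd
    obtain ⟨i, hi, e⟩ := ht.rigid.eq_of_isLeftDescent hd
    obtain rfl : l = i := by omega
    exact e
  have key : ¬L u v ≤ cs.length (cs.simple c * w) := by
    rw [e]
    intro h
    have : cs.length w ≤ cs.length (cs.simple c * w) := by exact_mod_cast h
    omega
  by_cases hcu : c = s k
  · have h5 := h2.le_simple_mul_of_not_isLeftDescent hc fun hd => hne (hcu.symm.trans (h4 hd))
    have h6 : BruhatLE cs u'.1 (cs.simple c * w) := by
      rw [hu] at h1
      have := h1.simple_mul_le_simple_mul hs.rigid.isLeftDescent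
      rwa [pathProd_succ, cs.simple_mul_simple_cancel_left, ← hcu, ← hu''] at this
    exact key (e1 ▸ L_le h6 h5)
  · have h5 := h1.le_simple_mul_of_not_isLeftDescent hc (mt h3 hcu)
    by_cases hcv : c = t l
    · have h6 : BruhatLE cs v'.1 (cs.simple c * w) := by
        rw [hv] at h2
        have := h2.simple_mul_le_simple_mul ht.rigid.isLeftDescent
        rwa [pathProd_succ, cs.simple_mul_simple_cancel_left, ← hcv, ← hv''] at this
      exact key (e2 ▸ L_le h5 h6)
    · exact key (L_le h5 (h2.le_simple_mul_of_not_isLeftDescent hc (mt h4 hcv)))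

/-- Two form (I) elements are equivalent iff their expressions start with the same letter. -/
theorem sim_iff {k l : ℕ} {s t : ℕ → B} (hs : IsSimpleSeq M J k s)
    (ht : IsSimpleSeq M J l t) {u v : MinRep cs J}
    (hu : u.1 = pathProd cs s (k + 1)) (hv : v.1 = pathProd cs t (l + 1)) :
    Sim u v ↔ s k = t l := by
  refine ⟨top_eq_of_sim hs ht hu hv, fun hst => ?_⟩
  obtain ⟨u', hu', hu''⟩ := hs.exists_isUniqueLowerCover hu
  obtain ⟨v', hv', hv''⟩ := ht.exists_isUniqueLowerCover hv
  refine ⟨u', v', hu'', hv'', L_eq_of_top_eq hs ht hst hu hv hu', ?_⟩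
  rw [L_comm, L_comm u v']
  exact L_eq_of_top_eq ht hs hst.symm hv hu hv'

end Sim

/-! ### The function `M(u,v)` -/

section Mfun

variable {B W : Type*} [Group W] {M : CoxeterMatrix B} {cs : CoxeterSystem M W} {J : Set B}

/-- Two simple expressions which differ only in the last letter. -/
structure Fork (M : CoxeterMatrix B) (J : Set B) (k : ℕ) (s t : ℕ → B) : Prop where
  left : IsSimpleSeq M J k s
  right : IsSimpleSeq M J k t
  eq : ∀ i < k, s i = t i
  ne : s k ≠ t k

theorem Fork.symm {k : ℕ} {s t : ℕ → B} (h : Fork M J k s t) : Fork M J k t s :=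
  ⟨h.right, h.left, fun i hi => (h.eq i hi).symm, h.ne.symm⟩

theorem Fork.rigid {k : ℕ} {s t : ℕ → B} (h : Fork M J k s t) {q : ℕ}
    (hq : M (s k) (t k) ≠ 0 → q < M (s k) (t k)) : Rigid M (extSeq s k (t k)) (k + q) := by
  refine rigid_extSeq h.left (fun i hi => ?_) (fun h0 => by have := hq h0; omega)
  rcases hi.eq_or_lt with rfl | hi
  · exact h.ne
  · rw [h.eq i hi]
    exact h.right.ne hi.le le_rfl hi.ne

theorem extSeq_swap (s t : ℕ → B) (k q : ℕ) :
    extSeq s k (t k) (k + (q + 1)) = extSeq t k (s k) (k + q) := by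
  rw [extSeq_add, extSeq_add]
  by_cases hq : Even q <;> simp [hq, Nat.even_add_one]

theorem Fork.not_isLeftDescent {k : ℕ} {s t : ℕ → B} (h : Fork M J k s t) {q : ℕ}
    (hq : M (s k) (t k) ≠ 0 → q < M (s k) (t k)) :
    ¬cs.IsLeftDescent (pathProd cs (extSeq s k (t k)) (k + q)) (extSeq s k (t k) (k + q)) := by
  intro hd
  obtain ⟨l, hl, e⟩ := (h.rigid hq).eq_of_isLeftDescent hd
  cases q with
  | zero =>
    rw [add_zero, extSeq_of_le le_rfl, extSeq_of_le (by omega)] at e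
    exact h.left.ne (i := k) le_rfl (by omega) (by omega) e
  | succ q =>
    obtain rfl : l = k + q := by omega
    rw [extSeq_add, extSeq_add] at e
    by_cases hq : Even q
    · simp [hq, Nat.even_add_one] at e
      exact h.ne e.symm
    · simp [hq, Nat.even_add_one] at e
      exact h.ne e

theorem Fork.length {k : ℕ} {s t : ℕ → B} (h : Fork M J k s t) {q : ℕ}
    (hq : M (s k) (t k) ≠ 0 → q < M (s k) (t k)) :
    cs.length (pathProd cs (extSeq s k (t k)) (k + q + 1)) =
      cs.length (pathProd cs (extSeq s k (t k)) (k + q)) + 1 := by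
  rw [pathProd_succ]
  exact cs.not_isLeftDescent_iff.1 (h.not_isLeftDescent hq)

/-- The two words begin with the same letter; cancelling it exchanges nothing but the length, so
lifting gives the induction. These are the cross relations between consecutive sets `M_i`. -/
theorem Fork.le {k : ℕ} {s t : ℕ → B} (h : Fork M J k s t) {q : ℕ}
    (hq : M (s k) (t k) ≠ 0 → q < M (s k) (t k)) :
    BruhatLE cs (pathProd cs (extSeq t k (s k)) (k + q))
      (pathProd cs (extSeq s k (t k)) (k + q + 1)) := by
  induction q with
  | zero =>
    have e : pathProd cs (extSeq t k (s k)) (k + 0) = pathProd cs (extSeq s k (t k)) (k + 0) :=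
      pathProd_congr fun i hi => by
        rw [extSeq_of_le (by omega), extSeq_of_le (by omega), h.eq i hi]
    rw [e, pathProd_succ]
    exact .simple_mul (h.not_isLeftDescent hq)
  | succ q ih =>
    rw [pathProd_succ _ (k + (q + 1)), extSeq_swap s t, ← add_assoc, pathProd_succ _ (k + q)]
    have := h.not_isLeftDescent (cs := cs) hq
    rw [extSeq_swap s t] at this
    exact (ih fun h0 => by have := hq h0; omega).simple_mul_le_simple_mul_of_not this

theorem Fork.braid {k : ℕ} {s t : ℕ → B} (h : Fork M J k s t) :
    pathProd cs (extSeq s k (t k)) (k + M (s k) (t k)) =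
      pathProd cs (extSeq t k (s k)) (k + M (s k) (t k)) := by
  have e := cs.wordProd_braidWord_eq (t k) (s k)
  simp only [CoxeterSystem.braidWord, M.symmetric (t k) (s k)] at e
  have e2 : descWord s k = descWord t k := descWord_congr h.eq
  rw [pathProd, pathProd, descWord_extSeq, descWord_extSeq, cs.wordProd_append,
    cs.wordProd_append, e2, e]

theorem Fork.isMin {k : ℕ} {s t : ℕ → B} (h : Fork M J k s t) {q : ℕ}
    (hq : M (s k) (t k) ≠ 0 → q < M (s k) (t k)) :
    IsMin cs J (pathProd cs (extSeq s k (t k)) (k + q)) := by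
  refine (h.rigid hq).isMin ?_
  rw [extSeq_of_le (Nat.zero_le k)]
  exact h.left.2.1

theorem Fork.pathProd_ne {k : ℕ} {s t : ℕ → B} (h : Fork M J k s t) {q : ℕ}
    (hq : M (s k) (t k) ≠ 0 → q < M (s k) (t k)) (h1 : 1 ≤ q) :
    pathProd cs (extSeq s k (t k)) (k + q) ≠ pathProd cs (extSeq t k (s k)) (k + q) := by
  intro e
  have := ((h.rigid hq).eq_of_pathProd_eq
    (h.symm.rigid (by rwa [M.symmetric])) e).2 k (by omega)
  rw [extSeq_of_le le_rfl, extSeq_of_le le_rfl] at this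
  exact h.ne this

/-- The new case is the merged element at `q + 1 = m`, whose word is not rigid. It covers the two
alternating products `x ≠ y`; a right descent `j ∈ J` would make it equal to both `x s_j` and `y
s_j`. -/
theorem Fork.isMin_succ {k : ℕ} {s t : ℕ → B} (h : Fork M J k s t) {q : ℕ}
    (hq : M (s k) (t k) ≠ 0 → q < M (s k) (t k)) :
    IsMin cs J (pathProd cs (extSeq s k (t k)) (k + q + 1)) := by
  by_cases hq' : M (s k) (t k) ≠ 0 → q + 1 < M (s k) (t k)
  · exact h.isMin hq'
  rw [Classical.not_imp] at hq'
  have e : M (s k) (t k) = q + 1 := by have := hq hq'.1; omega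
  have hq1 : 1 ≤ q := by
    have := M.off_diagonal _ _ h.ne
    omega
  have hb := h.braid (cs := cs)
  rw [e, ← add_assoc] at hb
  intro j hj hd
  have hq2 : M (t k) (s k) ≠ 0 → q < M (t k) (s k) := by rwa [M.symmetric]
  have h1 := h.isMin (cs := cs) hq j hj
  have h2 := h.symm.isMin (cs := cs) hq2 j hj
  apply h.pathProd_ne (cs := cs) hq hq1
  have hd' := hd
  rw [pathProd_succ] at hd
  rw [hb, pathProd_succ] at hd'
  have e1 := simple_mul_eq_mul_simple h1 hd
  have e2 := simple_mul_eq_mul_simple h2 hd'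
  rw [← pathProd_succ] at e1 e2
  rw [← hb, e1] at e2
  exact mul_right_cancel e2

/-- For a left descent `c` of `w`, each of `x` and `y` either begins with `c` or yields `w` by left
multiplication with `s_c`. Their first letters differ, so they do not both begin with `c`; if
neither did, `x = y`. Hence `w` extends one by the first letter of the other. -/
theorem Fork.eq_of_covBy {k : ℕ} {s t : ℕ → B} (h : Fork M J k s t) {q : ℕ}
    (hq : M (s k) (t k) ≠ 0 → q < M (s k) (t k)) (h1 : 1 ≤ q) {x y w : MinRep cs J}
    (hx : x.1 = pathProd cs (extSeq s k (t k)) (k + q))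
    (hy : y.1 = pathProd cs (extSeq t k (s k)) (k + q)) (hxw : x ⋖ w) (hyw : y ⋖ w) :
    w.1 = pathProd cs (extSeq s k (t k)) (k + q + 1) ∨
      w.1 = pathProd cs (extSeq t k (s k)) (k + q + 1) := by
  have hq2 : M (t k) (s k) ≠ 0 → q < M (t k) (s k) := by rwa [M.symmetric]
  have hw1 : w.1 ≠ 1 := by
    intro h2
    have := MinRep.length_strictMono hxw.lt
    rw [h2, cs.length_one] at this
    omega
  obtain ⟨c, v, hc, hv, hvw⟩ := MinRep.exists_isLeftDescent hw1
  have key : ∀ {z : MinRep cs J}, z ⋖ w → ¬cs.IsLeftDescent z.1 c → w.1 = cs.simple c * z.1 := by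
    intro z hzw hz
    have h3 : BruhatLE cs z.1 v.1 := by
      rw [hv]
      exact BruhatLE.le_simple_mul_of_not_isLeftDescent (show BruhatLE cs z.1 w.1 from hzw.le)
        hc hz
    have h4 : z = v := by
      by_contra hne
      exact hzw.2 (lt_of_le_of_ne h3 hne) hvw.lt
    rw [h4, hv, cs.simple_mul_simple_cancel_left]
  obtain ⟨r, rfl⟩ : ∃ r, q = r + 1 := ⟨q - 1, by omega⟩
  have hdx : cs.IsLeftDescent x.1 c → c = extSeq s k (t k) (k + r) := by
    rw [hx]
    intro hd
    obtain ⟨l, hl, e⟩ := (h.rigid hq).eq_of_isLeftDescent hd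
    obtain rfl : l = k + r := by omega
    exact e
  have hdy : cs.IsLeftDescent y.1 c → c = extSeq t k (s k) (k + r) := by
    rw [hy]
    intro hd
    obtain ⟨l, hl, e⟩ := (h.symm.rigid hq2).eq_of_isLeftDescent hd
    obtain rfl : l = k + r := by omega
    exact e
  by_cases hdx' : cs.IsLeftDescent x.1 c
  · by_cases hdy' : cs.IsLeftDescent y.1 c
    · exfalso
      have e := (hdx hdx').symm.trans (hdy hdy')
      rw [extSeq_add, extSeq_add] at e
      split_ifs at e
      · exact h.ne e
      · exact h.ne e.symm
    · right
      rw [key hyw hdy', hy, pathProd_succ, hdx hdx', extSeq_swap t s]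
  · left
    by_cases hdy' : cs.IsLeftDescent y.1 c
    · rw [key hxw hdx', hx, pathProd_succ, hdy hdy', extSeq_swap s t]
    · exfalso
      have e := (key hxw hdx').symm.trans (key hyw hdy')
      rw [mul_right_inj, hx, hy] at e
      exact h.pathProd_ne hq h1 e

theorem Fork.Mset_eq {k : ℕ} {s t : ℕ → B} (h : Fork M J k s t) {u v : MinRep cs J}
    (hu : u.1 = pathProd cs s (k + 1)) (hv : v.1 = pathProd cs t (k + 1)) {q : ℕ}
    (hq : M (s k) (t k) ≠ 0 → q < M (s k) (t k)) :
    Mset u v (q + 1) = {w | w.1 = pathProd cs (extSeq s k (t k)) (k + q + 1) ∨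
      w.1 = pathProd cs (extSeq t k (s k)) (k + q + 1)} := by
  induction q with
  | zero =>
    have e1 : pathProd cs (extSeq s k (t k)) (k + 0 + 1) = u.1 := by
      rw [hu]; exact pathProd_congr fun i hi => extSeq_of_le (by omega)
    have e2 : pathProd cs (extSeq t k (s k)) (k + 0 + 1) = v.1 := by
      rw [hv]; exact pathProd_congr fun i hi => extSeq_of_le (by omega)
    rw [e1, e2]
    ext w
    simp only [Mset, Set.mem_insert_iff, Set.mem_singleton_iff, Set.mem_ofPred_eq, MinRep.eq_iff]
  | succ q ih =>
    have hq1 : M (s k) (t k) ≠ 0 → q < M (s k) (t k) := fun h0 => by have := hq h0; omega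
    have hq' : M (t k) (s k) ≠ 0 → q + 1 < M (t k) (s k) := by rwa [M.symmetric]
    have hx := h.isMin (cs := cs) hq
    have hy := h.symm.isMin (cs := cs) hq'
    ext w
    simp only [Mset, ih hq1, Set.mem_ofPred_eq]
    constructor
    · intro hw
      exact h.eq_of_covBy hq (by omega) (x := hx.toMinRep) (y := hy.toMinRep) rfl rfl
        (hw _ (Or.inl rfl)) (hw _ (Or.inr rfl))
    · rintro hw z hz
      have hlx := h.length (cs := cs) hq
      have hly := h.symm.length (cs := cs) hq'
      have hex := (h.rigid hq).length (cs := cs)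
      have hey := (h.symm.rigid hq').length (cs := cs)
      have hxx := BruhatLE.simple_mul (h.not_isLeftDescent (cs := cs) hq)
      have hyy := BruhatLE.simple_mul (h.symm.not_isLeftDescent (cs := cs) hq')
      rw [← pathProd_succ] at hxx hyy
      rcases hw with hw | hw <;> rcases hz with hz | hz <;> refine MinRep.covBy ?_ ?_ <;>
        rw [hw, hz]
      · exact hxx
      · exact hlx
      · exact h.le hq
      · exact hlx.trans (by rw [hex, add_assoc k q 1, hey])
      · exact h.symm.le hq'
      · exact hly.trans (by rw [hey, add_assoc k q 1, hex])
      · exact hyy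
      · exact hly

/-- The two members of `M_i` differ by rigidity while `i < m`, and the braid relation identifies
them at `i = m`. -/
theorem Fork.Mfun_eq {k : ℕ} {s t : ℕ → B} (h : Fork M J k s t) {u v : MinRep cs J}
    (hu : u.1 = pathProd cs s (k + 1)) (hv : v.1 = pathProd cs t (k + 1)) :
    Mfun u v = m M (s k) (t k) := by
  have h2 : ∀ q, 1 ≤ q → (M (s k) (t k) ≠ 0 → q < M (s k) (t k)) →
      (Mset u v q).encard = 2 := by
    intro q h1 hq
    obtain ⟨r, rfl⟩ : ∃ r, q = r + 1 := ⟨q - 1, by omega⟩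
    rw [h.Mset_eq hu hv fun h0 => by have := hq h0; omega]
    have hq' : M (t k) (s k) ≠ 0 → r + 1 < M (t k) (s k) := by rwa [M.symmetric]
    have e : {w : MinRep cs J | w.1 = pathProd cs (extSeq s k (t k)) (k + r + 1) ∨
        w.1 = pathProd cs (extSeq t k (s k)) (k + r + 1)} =
        {(h.isMin hq).toMinRep, (h.symm.isMin hq').toMinRep} := by
      ext w
      simp only [Set.mem_insert_iff, Set.mem_singleton_iff, Set.mem_ofPred_eq, MinRep.eq_iff]
      rfl
    rw [e, Set.encard_pair]
    intro e2
    exact h.pathProd_ne hq (by omega) (congrArg Subtype.val e2)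
  have hle : m M (s k) (t k) ≤ Mfun u v := by
    refine le_iInf₂ fun i hi => ?_
    by_contra hlt
    rw [not_le, natCast_lt_m] at hlt
    have := h2 i (by omega) (fun h0 => hlt.resolve_left h0)
    rw [hi.2] at this
    exact absurd this (by norm_num)
  refine le_antisymm ?_ hle
  by_cases h0 : M (s k) (t k) = 0
  · simp [m, h0]
  · have h1 := M.off_diagonal _ _ h.ne
    obtain ⟨q, hq⟩ : ∃ q, M (s k) (t k) = q + 1 := ⟨M (s k) (t k) - 1, by omega⟩
    rw [m, if_neg h0]
    refine iInf₂_le (f := fun (i : ℕ) (_ : 2 ≤ i ∧ (Mset u v i).encard = 1) => (i : ℕ∞))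
      (M (s k) (t k)) ⟨by omega, ?_⟩
    have hb := h.braid (cs := cs)
    have hM := h.isMin_succ (cs := cs) (q := q) (by omega)
    rw [hq] at hb ⊢
    rw [← add_assoc] at hb
    rw [h.Mset_eq hu hv (by omega), ← hb, Set.encard_eq_one]
    refine ⟨hM.toMinRep, ?_⟩
    ext w
    simp only [or_self, Set.mem_singleton_iff, Set.mem_ofPred_eq, MinRep.eq_iff]
    rfl

end Mfun

/-! ### Form (II) and form (III) elements -/

section Labels

variable {B W : Type*} [Group W] {M : CoxeterMatrix B} {cs : CoxeterSystem M W} {J : Set B}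

theorem foldSeq_eq_extSeq (s : ℕ → B) (k : ℕ) {i : ℕ} (hi : i < k + 3) :
    foldSeq s (k + 1) i = extSeq s k (s (k + 1)) i := by
  rcases Nat.lt_or_ge i (k + 2) with h | h
  · rw [extSeq_of_le' (by omega), foldSeq, if_pos (by omega)]
  · obtain rfl : i = k + 2 := by omega
    rw [extSeq_add, foldSeq, if_neg (by omega), if_pos (by decide)]
    congr 1
    omega

theorem IsSimpleSeq.rigid_extSeq {k p : ℕ} {s : ℕ → B} (h : IsSimpleSeq M J (k + 1) s)
    (hp : (p : ℕ∞) < m M (s (k + 1)) (s k)) : Rigid M (extSeq s k (s (k + 1))) (k + p) := by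
  rw [m_comm, natCast_lt_m] at hp
  exact BWCoxeter.rigid_extSeq (h.mono (Nat.le_succ k))
    (fun i hi => h.ne (by omega) le_rfl (by omega)) (by omega)

theorem hasForm_II_iff {w : MinRep cs J} : HasForm cs J .II w ↔ ∃ (k l : ℕ) (s : ℕ → B),
    IsSimpleSeq M J (l + k + 1) s ∧ 4 ≤ m M (s (l + k + 1)) (s (l + k)) ∧
      (∀ i, l ≤ i → i < l + k → m M (s i) (s (i + 1)) = 3) ∧
      w.1 = pathProd cs (foldSeq s (l + k + 1)) (l + k + 3 + k) := by
  have e : ∀ (s : ℕ → B) (k l : ℕ), pathProd cs (foldSeq s (l + k + 1)) (l + k + 3 + k) =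
      cs.wordProd (ascWord s l (l + k + 1) ++ descWord s (l + k + 1 + 1)) := by
    intro s k l
    have := descWord_foldSeq s l (k + 1)
    rw [← add_assoc] at this
    rw [← this, pathProd]
    congr 2
    omega
  constructor
  · rintro ⟨k, s, hs, l, hl, h4, h3, hw⟩
    obtain ⟨d, rfl⟩ : ∃ d, k = l + d + 1 := ⟨k - l - 1, by omega⟩
    exact ⟨d, l, s, hs, h4, fun i hi hi' => h3 i hi (by omega), hw.trans (e s d l).symm⟩
  · rintro ⟨d, l, s, hs, h4, h3, hw⟩
    exact ⟨l + d + 1, s, hs, l, by omega, h4, fun i hi hi' => h3 i hi (by omega),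
      hw.trans (e s d l)⟩

theorem mem_chainForms_II {k : ℕ} {s : ℕ → B} (h : IsSimpleSeq M J (k + 1) s)
    (h4 : 4 ≤ m M (s (k + 1)) (s k)) {w : MinRep cs J}
    (hw : w.1 = pathProd cs (extSeq s k (s (k + 1))) (k + 3)) : w ∈ chainForms cs J .II := by
  refine ⟨chainlike_of_chainCond (h.rigid_extSeq (p := 3) ?_) (chainCond_extSeq h) ?_ hw,
    hasForm_II_iff.2 ⟨0, k, s, h, h4, fun i hi hi' => by omega, hw.trans ?_⟩⟩
  · exact lt_of_lt_of_le (by norm_num) h4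
  · rw [extSeq_of_le (Nat.zero_le k)]
    exact h.2.1
  · exact pathProd_congr fun i hi => (foldSeq_eq_extSeq s k hi).symm

/-- A form (II) element covering a form (I) element arises from the one of form (I) by
multiplication with one letter. -/
theorem exists_of_mem_chainForms_II {u u' : MinRep cs J} (hu : u ∈ chainForms cs J .II)
    (hu' : u' ∈ chainForms cs J .I) (h : IsUniqueLowerCover u' u) :
    ∃ (k : ℕ) (s : ℕ → B), IsSimpleSeq M J (k + 1) s ∧ 4 ≤ m M (s (k + 1)) (s k) ∧
      u.1 = pathProd cs (extSeq s k (s (k + 1))) (k + 3) ∧ u'.1 = pathProd cs s (k + 2) := by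
  obtain ⟨k, l, s, hs, h4, -, hw⟩ := hasForm_II_iff.1 hu.2
  obtain ⟨j, t, ht, hw'⟩ := mem_chainForms_I.1 hu'
  have hr : Rigid M (foldSeq s (l + k + 1)) (l + k + 2 + k + 1) :=
    rigid_foldSeq hs h4 (by omega)
  rw [show l + k + 3 + k = l + k + 2 + k + 1 by omega] at hw
  have h0 : foldSeq s (l + k + 1) 0 ∉ J := by simpa [foldSeq] using hs.2.1
  have hr' := hr.mono (Nat.le_succ _)
  have hcov : hr'.toMinRep cs h0 ⋖ u :=
    MinRep.covBy_simple_mul (hr.not_isLeftDescent (cs := cs))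
      (by rw [hw, pathProd_succ]; rfl)
  have e := congrArg Subtype.val (h.2 _ hcov)
  rw [hw'] at e
  obtain ⟨e1, e2⟩ := hr'.eq_of_pathProd_eq ht.rigid e
  cases k with
  | zero =>
    refine ⟨l, s, hs, h4, hw.trans (pathProd_congr fun i hi => foldSeq_eq_extSeq s l hi), ?_⟩
    rw [hw', ← e, Rigid.toMinRep, IsMin.toMinRep]
    exact pathProd_congr fun i hi => by rw [foldSeq, if_pos (by omega)]
  | succ k =>
    exfalso
    -- With a longer fold, `u'` still contains the turning point and repeats a letter, unlike a form
    -- (I) word.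
    have h1 := e2 (l + (k + 1)) (by omega)
    have h2 := e2 (l + (k + 1) + 2) (by omega)
    rw [foldSeq, if_pos (by omega)] at h1
    rw [foldSeq, if_neg (by omega),
      show 2 * (l + (k + 1) + 1) - (l + (k + 1) + 2) = l + (k + 1) by omega] at h2
    exact ht.ne (by omega) (by omega) (by omega) (h1.symm.trans h2)

theorem mem_chainForms_III {w : MinRep cs J} : w ∈ chainForms cs J .III ↔
    ∃ (k : ℕ) (s : ℕ → B) (p : ℕ), IsSimpleSeq M J (k + 1) s ∧ 4 ≤ p ∧
      (p : ℕ∞) < m M (s (k + 1)) (s k) ∧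
      w.1 = pathProd cs (extSeq s k (s (k + 1))) (k + p) := by
  constructor
  · rintro ⟨-, k, s, hs, hk, p, hp, hpm, hw⟩
    obtain ⟨k, rfl⟩ : ∃ l, k = l + 1 := ⟨k - 1, by omega⟩
    refine ⟨k, s, p, hs, hp, hpm, ?_⟩
    rw [pathProd, descWord_extSeq]
    exact hw
  · rintro ⟨k, s, p, hs, hp, hpm, hw⟩
    refine ⟨?_, k + 1, s, hs, by omega, p, hp, hpm, ?_⟩
    · obtain ⟨q, rfl⟩ : ∃ q, p = q + 1 := ⟨p - 1, by omega⟩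
      refine chainlike_of_chainCond (n := k + q) (hs.rigid_extSeq hpm) (chainCond_extSeq hs) ?_ hw
      rw [extSeq_of_le (Nat.zero_le k)]
      exact hs.2.1
    · rw [hw, pathProd, descWord_extSeq]
      rfl

/-- The smaller word is a right end segment of the larger one, since the lower set is a chain. The
first place where letters two apart agree determines `k`, and similarly `l`. -/
theorem eq_of_pathProd_extSeq_le {k l p : ℕ} {s t : ℕ → B} (hs : IsSimpleSeq M J (k + 1) s)
    (ht : IsSimpleSeq M J (l + 1) t) (hs4 : 4 ≤ m M (s (k + 1)) (s k))
    (hp : (p : ℕ∞) < m M (t (l + 1)) (t l))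
    (h : BruhatLE cs (pathProd cs (extSeq s k (s (k + 1))) (k + 3))
      (pathProd cs (extSeq t l (t (l + 1))) (l + p))) :
    k = l ∧ ∀ i ≤ k + 1, s i = t i := by
  have hrs : Rigid M (extSeq s k (s (k + 1))) (k + 3) :=
    hs.rigid_extSeq (p := 3) (lt_of_lt_of_le (by norm_num) hs4)
  have hrt := ht.rigid_extSeq hp
  have hmin : IsMin cs J (pathProd cs (extSeq s k (s (k + 1))) (k + 3)) := by
    refine hrs.isMin ?_
    rw [extSeq_of_le (Nat.zero_le k)]
    exact hs.2.1
  obtain ⟨j, hj, e⟩ := eq_pathProd_of_le hrt (chainCond_extSeq ht) le_rfl hmin h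
  obtain ⟨rfl, e2⟩ := hrs.eq_of_pathProd_eq (hrt.mono hj) e
  have hkl : k = l := by
    rcases lt_trichotomy k l with hlt | rfl | hlt
    · exfalso
      have h1 := e2 k (by omega)
      have h2 := e2 (k + 2) (by omega)
      rw [extSeq_of_le' (by omega), extSeq_of_le' (by omega)] at h1
      rw [extSeq_add, if_pos (by decide), extSeq_of_le' (by omega)] at h2
      exact ht.ne (by omega) (by omega) (by omega) (h1.symm.trans h2)
    · rfl
    · exfalso
      have h1 := e2 l (by omega)
      have h2 := e2 (l + 2) (by omega)
      rw [extSeq_of_le' (by omega), extSeq_of_le' (by omega)] at h1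
      rw [extSeq_add, if_pos (by decide), extSeq_of_le' (by omega)] at h2
      exact hs.ne (by omega) (by omega) (by omega) (h1.trans h2.symm)
  subst hkl
  refine ⟨rfl, fun i hi => ?_⟩
  have := e2 i (by omega)
  rwa [extSeq_of_le' hi, extSeq_of_le' hi] at this

theorem encard_add_four {a : ℕ∞} (ha : 4 ≤ a) :
    {p : ℕ | 4 ≤ p ∧ (p : ℕ∞) < a}.encard + 4 = a := by
  induction a using ENat.recTopCoe with
  | top =>
    have : {p : ℕ | 4 ≤ p ∧ (p : ℕ∞) < ⊤} = Set.Ici 4 := by ext; simp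
    rw [this, (Set.Ici_infinite 4).encard_eq, top_add]
  | coe n =>
    have ha' : 4 ≤ n := by exact_mod_cast ha
    have : {p : ℕ | 4 ≤ p ∧ (p : ℕ∞) < n} = (Finset.Ico 4 n : Set ℕ) := by ext; simp
    rw [this, Set.encard_coe_eq_coe_finsetCard, Nat.card_Ico]
    exact_mod_cast Nat.sub_add_cancel ha'

/-- The number of form (III) elements above a form (II) element determines the label. -/
theorem encard_form_III {k : ℕ} {s : ℕ → B} (hs : IsSimpleSeq M J (k + 1) s)
    (h4 : 4 ≤ m M (s (k + 1)) (s k)) {u : MinRep cs J}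
    (hu : u.1 = pathProd cs (extSeq s k (s (k + 1))) (k + 3)) :
    {w | w ∈ chainForms cs J .III ∧ u < w}.encard + 4 = m M (s (k + 1)) (s k) := by
  rw [← encard_add_four h4]
  congr 1
  have h0 : extSeq s k (s (k + 1)) 0 ∉ J := by
    rw [extSeq_of_le (Nat.zero_le k)]
    exact hs.2.1
  -- Counting takes place in `W`, where the products are defined for every `p` without a proof of
  -- minimality.
  have himage : Subtype.val '' {w : MinRep cs J | w ∈ chainForms cs J .III ∧ u < w} =
      (fun p => pathProd cs (extSeq s k (s (k + 1))) (k + p)) ''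
        {p : ℕ | 4 ≤ p ∧ (p : ℕ∞) < m M (s (k + 1)) (s k)} := by
    ext x
    constructor
    · rintro ⟨w, ⟨hw, huw⟩, rfl⟩
      obtain ⟨l, t, p, ht, hp, hpm, e⟩ := mem_chainForms_III.1 hw
      have hle : BruhatLE cs u.1 w.1 := huw.le
      rw [hu, e] at hle
      obtain ⟨rfl, e2⟩ := eq_of_pathProd_extSeq_le hs ht h4 hpm hle
      rw [← e2 k (by omega), ← e2 (k + 1) le_rfl] at hpm
      refine ⟨p, ⟨hp, hpm⟩, ?_⟩
      rw [e]
      refine pathProd_congr fun i hi => ?_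
      rcases Nat.lt_or_ge i k with h | h
      · rw [extSeq_of_le h.le, extSeq_of_le h.le, e2 i (by omega)]
      · obtain ⟨r, rfl⟩ := Nat.exists_eq_add_of_le h
        rw [extSeq_add, extSeq_add, e2 k (by omega), e2 (k + 1) le_rfl]
    · rintro ⟨p, ⟨hp, hpm⟩, rfl⟩
      have hr := hs.rigid_extSeq hpm
      have hw : (hr.toMinRep cs h0 : MinRep cs J) ∈ chainForms cs J .III :=
        mem_chainForms_III.2 ⟨k, s, p, hs, hp, hpm, rfl⟩
      refine ⟨hr.toMinRep cs h0, ⟨hw, lt_of_le_of_ne ?_ ?_⟩, rfl⟩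
      · change BruhatLE cs u.1 _
        rw [hu]
        exact hr.pathProd_le (by omega)
      · intro e
        have e1 := congrArg (fun w : MinRep cs J => cs.length w.1) e
        simp only [hu, Rigid.toMinRep, IsMin.toMinRep] at e1
        rw [hr.length, (hr.mono (show k + 3 ≤ k + p by omega)).length] at e1
        omega
  refine (Function.Injective.encard_image (f := (Subtype.val : MinRep cs J → W))
    Subtype.val_injective _).symm.trans ((congrArg Set.encard himage).trans
    (Set.InjOn.encard_image ?_))
  rintro p ⟨-, hp⟩ q ⟨-, hq⟩ e
  have e1 := congrArg cs.length e
  simp only at e1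
  rw [(hs.rigid_extSeq hp).length, (hs.rigid_extSeq hq).length] at e1
  omega

end Labels

/-! ### Simple expressions ending in a given generator -/

section Graph

variable {B : Type*} {M : CoxeterMatrix B} {J : Set B}

/-- A function on the vertices with the properties of the distance to the complement of `J` in the
Coxeter graph. -/
structure IsDistance (M : CoxeterMatrix B) (J : Set B) (d : B → ℕ) : Prop where
  eq_zero_iff : ∀ s, d s = 0 ↔ s ∉ J
  le : ∀ s t, 3 ≤ m M s t → d t ≤ d s + 1
  exists_pred : ∀ s n, d s = n + 1 → ∃ t, 3 ≤ m M t s ∧ d t = n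

theorem exists_isDistance (hirr : (coxeterGraph M).Connected) (hJ : J ≠ Set.univ) :
    ∃ d, IsDistance M J d := by
  obtain ⟨b, hb⟩ := (Set.ne_univ_iff_exists_notMem J).1 hJ
  have hne : ∀ s, {n | ∃ b, b ∉ J ∧ (coxeterGraph M).dist s b = n}.Nonempty :=
    fun s => ⟨_, b, hb, rfl⟩
  let d : B → ℕ := fun s => sInf {n | ∃ b, b ∉ J ∧ (coxeterGraph M).dist s b = n}
  have hd : ∀ s, ∃ b, b ∉ J ∧ (coxeterGraph M).dist s b = d s := fun s => Nat.sInf_mem (hne s)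
  have hle : ∀ s b, b ∉ J → d s ≤ (coxeterGraph M).dist s b :=
    fun s b hb => Nat.sInf_le ⟨b, hb, rfl⟩
  have hadj : ∀ s t, 3 ≤ m M s t → d t ≤ d s + 1 := by
    intro s t hst
    obtain ⟨b, hb, e⟩ := hd s
    have h1 := hle t b hb
    have h2 := hirr.dist_triangle (u := t) (v := s) (w := b)
    have h3 : (coxeterGraph M).dist t s = 1 :=
      SimpleGraph.dist_eq_one_iff_adj.2 (show 3 ≤ m M t s by rwa [m_comm])
    omega
  refine ⟨d, fun s => ⟨fun h => ?_, fun h => ?_⟩, hadj, fun s n hs => ?_⟩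
  · obtain ⟨b, hb, e⟩ := hd s
    rw [h, hirr.dist_eq_zero_iff] at e
    rwa [e]
  · have := hle s s h
    rw [SimpleGraph.dist_self] at this
    omega
  · obtain ⟨b, hb, e⟩ := hd s
    obtain ⟨p, hp⟩ := hirr.exists_walk_length_eq_dist s b
    rw [e, hs] at hp
    cases p with
    | nil => simp at hp
    | cons h p =>
      rename_i t
      have h' : 3 ≤ m M s t := h
      have h'' : 3 ≤ m M t s := by rwa [m_comm]
      refine ⟨t, h'', ?_⟩
      have h1 := hadj t s h''
      have h2 := (hle t b hb).trans (SimpleGraph.dist_le p)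
      rw [SimpleGraph.Walk.length_cons] at hp
      omega

/-- Adjacent vertices have distances differing by at most one, so a path along which the distance
grows has no repetitions and no chords. -/
theorem IsDistance.isSimpleSeq {d : B → ℕ} (hd : IsDistance M J d) {n : ℕ} {f : ℕ → B}
    (h1 : ∀ i ≤ n, d (f i) = i) (h2 : ∀ i < n, 3 ≤ m M (f i) (f (i + 1))) :
    IsSimpleSeq M J n f := by
  have hinj : ∀ i ≤ n, ∀ j ≤ n, f i = f j → i = j := fun i hi j hj e => by
    rw [← h1 i hi, ← h1 j hj, e]
  refine ⟨hinj, (hd.eq_zero_iff _).1 (h1 0 (by omega)), fun i hi hi' => ?_,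
    fun i hi j hj => ⟨fun h => ?_, ?_⟩⟩
  · by_contra h
    have := (hd.eq_zero_iff _).2 h
    rw [h1 i hi'] at this
    omega
  · have h3 := hd.le _ _ h
    rw [m_comm] at h
    have h4 := hd.le _ _ h
    rw [h1 i hi, h1 j hj] at h3 h4
    have hij : i ≠ j := by
      rintro rfl
      rw [m_self] at h
      exact absurd h (by decide)
    omega
  · rintro (rfl | rfl)
    · exact h2 i (by omega)
    · rw [m_comm]; exact h2 j (by omega)

theorem IsDistance.exists_geodesic {d : B → ℕ} (hd : IsDistance M J d) (s : B) :
    ∃ f : ℕ → B, f (d s) = s ∧ (∀ i ≤ d s, d (f i) = i) ∧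
      ∀ i < d s, 3 ≤ m M (f i) (f (i + 1)) := by
  induction hn : d s generalizing s with
  | zero => exact ⟨fun _ => s, rfl, fun i hi => by rw [hn]; omega, by simp⟩
  | succ n ih =>
    obtain ⟨t, ht, htn⟩ := hd.exists_pred s n hn
    obtain ⟨f, h1, h2, h3⟩ := ih t htn
    refine ⟨fun i => if i ≤ n then f i else s, by simp, fun i hi => ?_, fun i hi => ?_⟩
    · dsimp only
      split_ifs with h
      · exact h2 i h
      · rw [hn]; omega
    · dsimp only
      rw [if_pos (by omega)]
      split_ifs with h
      · exact h3 i (by omega)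
      · obtain rfl : i = n := by omega
        rwa [h1]

theorem IsSimpleSeq.snoc {n : ℕ} {s : ℕ → B} (h : IsSimpleSeq M J n s) {b : B} (hb : b ∈ J)
    (hne : ∀ i ≤ n, s i ≠ b) (hadj : ∀ i ≤ n, 3 ≤ m M (s i) b ↔ i = n) :
    IsSimpleSeq M J (n + 1) (fun i => if i ≤ n then s i else b) := by
  refine ⟨fun i hi j hj e => ?_, by simpa using h.2.1, fun i h1 hi => ?_, fun i hi j hj => ?_⟩
  · dsimp only at e
    split_ifs at e with h1 h2 h2
    · exact h.1 i h1 j h2 e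
    · exact absurd e (hne i h1)
    · exact absurd e.symm (hne j h2)
    · omega
  · dsimp only
    split_ifs with h2
    · exact h.2.2.1 i h1 h2
    · exact hb
  · dsimp only
    split_ifs with h1 h2 h2
    · exact h.2.2.2 i h1 j h2
    · rw [hadj i h1]; omega
    · rw [m_comm, hadj j h2]; omega
    · rw [m_self]
      exact iff_of_false (by decide) (by omega)

theorem exists_isSimpleSeq (hirr : (coxeterGraph M).Connected) (hJ : J ≠ Set.univ) (b : B) :
    ∃ (k : ℕ) (s : ℕ → B), IsSimpleSeq M J k s ∧ s k = b := by
  obtain ⟨d, hd⟩ := exists_isDistance hirr hJ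
  obtain ⟨f, h1, h2, h3⟩ := hd.exists_geodesic b
  exact ⟨d b, f, hd.isSimpleSeq h2 h3, h1⟩

/-- Every edge of the Coxeter graph is visible in a simple expression, or in two simple
expressions which differ only in the last letter. -/
theorem exists_of_adj (hirr : (coxeterGraph M).Connected) (hJ : J ≠ Set.univ) {s t : B}
    (hst : 3 ≤ m M s t) :
    (∃ k f, IsSimpleSeq M J (k + 1) f ∧ f k = s ∧ f (k + 1) = t) ∨
    (∃ k f, IsSimpleSeq M J (k + 1) f ∧ f k = t ∧ f (k + 1) = s) ∨
    ∃ k f g, Fork M J k f g ∧ f k = s ∧ g k = t := by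
  obtain ⟨d, hd⟩ := exists_isDistance hirr hJ
  wlog hle : d s ≤ d t generalizing s t
  · rcases this (s := t) (t := s) (by rwa [m_comm]) (by omega) with h | h | ⟨k, f, g, h, h1, h2⟩
    · exact Or.inr (Or.inl h)
    · exact Or.inl h
    · exact Or.inr (Or.inr ⟨k, g, f, h.symm, h2, h1⟩)
  have hne : s ≠ t := by
    rintro rfl
    rw [m_self] at hst
    exact absurd hst (by decide)
  have hle' := hd.le s t hst
  obtain ⟨f, h1, h2, h3⟩ := hd.exists_geodesic s
  have hf := hd.isSimpleSeq h2 h3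
  have htJ : d t ≠ 0 → t ∈ J := fun h => by
    by_contra hcon
    exact h ((hd.eq_zero_iff t).2 hcon)
  rcases hle.eq_or_lt with heq | hlt
  · cases hn : d s with
    | zero =>
      obtain ⟨g, h4, h5, h6⟩ := hd.exists_geodesic t
      have hg := hd.isSimpleSeq h5 h6
      rw [← heq, hn] at h4 hg
      rw [hn] at h1 hf
      exact Or.inr (Or.inr ⟨0, f, g, ⟨hf, hg, by simp, by rwa [h1, h4]⟩, h1, h4⟩)
    | succ n =>
      rw [hn] at h1 h2 h3 hf heq
      -- Both ends have the same distance. If the predecessor of `s` is adjacent to `t` as well,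
      -- exchanging the end vertex gives a fork; if not, `t` can be appended to the path without
      -- creating a chord.
      by_cases hadj : 3 ≤ m M (f n) t
      · have hg : IsSimpleSeq M J (n + 1) (fun i => if i ≤ n then f i else t) := by
          refine hd.isSimpleSeq (fun i hi => ?_) (fun i hi => ?_)
          · split_ifs with h
            · exact h2 i hi
            · omega
          · rw [if_pos (by omega)]
            split_ifs with h
            · exact h3 i hi
            · obtain rfl : i = n := by omega
              exact hadj
        refine Or.inr (Or.inr ⟨n + 1, f, _, ⟨hf, hg, fun i hi => ?_, ?_⟩, h1, by simp⟩)
        · rw [if_pos (by omega)]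
        · simpa [h1] using hne
      · refine Or.inl ⟨n + 1, _, hf.snoc (htJ (by omega)) (fun i hi => ?_)
          (fun i hi => ⟨fun h => ?_, ?_⟩), by simpa using h1, by simp⟩
        · rintro rfl
          have := h2 i hi
          obtain rfl : i = n + 1 := by omega
          exact hne h1.symm
        · have h4 := hd.le _ _ h
          rw [h2 i hi] at h4
          by_contra hin
          obtain rfl : i = n := by omega
          exact hadj h
        · rintro rfl
          rwa [h1]
  · refine Or.inl ⟨d s, _, hf.snoc (htJ (by omega)) (fun i hi => ?_)
      (fun i hi => ⟨fun h => ?_, ?_⟩), by simpa using h1, by simp⟩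
    · rintro rfl
      have := h2 i hi
      omega
    · have h4 := hd.le _ _ h
      rw [h2 i hi] at h4
      omega
    · rintro rfl
      rwa [h1]

end Graph

/-! ### The construction recovers the graph -/

section Main

variable {B W : Type*} [Group W] {M : CoxeterMatrix B} {cs : CoxeterSystem M W} {J : Set B}

/-- The form (I) elements whose expression starts with `b`. -/
def topClass (cs : CoxeterSystem M W) (J : Set B) (b : B) : Set (MinRep cs J) :=
  {w | ∃ (k : ℕ) (s : ℕ → B), IsSimpleSeq M J k s ∧ s k = b ∧ w.1 = pathProd cs s (k + 1)}

theorem mem_chainForms_I_iff_exists_mem_topClass {w : MinRep cs J} :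
    w ∈ chainForms cs J .I ↔ ∃ b, w ∈ topClass cs J b := by
  rw [mem_chainForms_I]
  constructor
  · rintro ⟨k, s, hs, hw⟩
    exact ⟨s k, k, s, hs, rfl, hw⟩
  · rintro ⟨b, k, s, hs, -, hw⟩
    exact ⟨k, s, hs, hw⟩

theorem eq_of_mem_topClass {w : MinRep cs J} {b : B} {k : ℕ} {s : ℕ → B}
    (h : w ∈ topClass cs J b) (hs : IsSimpleSeq M J k s) (hw : w.1 = pathProd cs s (k + 1)) :
    b = s k := by
  obtain ⟨l, t, ht, rfl, hw'⟩ := h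
  obtain ⟨e1, e2⟩ := ht.rigid.eq_of_pathProd_eq hs.rigid (hw'.symm.trans hw)
  obtain rfl : l = k := by omega
  exact e2 l (by omega)

theorem topClass_unique {w : MinRep cs J} {b c : B} (hb : w ∈ topClass cs J b)
    (hc : w ∈ topClass cs J c) : b = c := by
  obtain ⟨k, s, hs, rfl, hw⟩ := hc
  exact eq_of_mem_topClass hb hs hw

theorem simClass_eq {u : MinRep cs J} {b : B} (hu : u ∈ topClass cs J b) :
    simClass (chainForms cs J) u = topClass cs J b := by
  obtain ⟨k, s, hs, rfl, hu⟩ := hu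
  ext v
  constructor
  · rintro ⟨hv, hsim⟩
    obtain ⟨l, t, ht, hv⟩ := mem_chainForms_I.1 hv
    exact ⟨l, t, ht, ((sim_iff hs ht hu hv).1 hsim).symm, hv⟩
  · rintro ⟨l, t, ht, e, hv⟩
    exact ⟨mem_chainForms_I.2 ⟨l, t, ht, hv⟩, (sim_iff hs ht hu hv).2 e.symm⟩

theorem equivalence_simI : Equivalence (SimI (chainForms cs J)) := by
  have key : ∀ u v : chainForms cs J .I, SimI (chainForms cs J) u v ↔
      ∃ b, u.1 ∈ topClass cs J b ∧ v.1 ∈ topClass cs J b := by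
    intro u v
    obtain ⟨k, s, hs, hu⟩ := mem_chainForms_I.1 u.2
    obtain ⟨l, t, ht, hv⟩ := mem_chainForms_I.1 v.2
    rw [SimI, sim_iff hs ht hu hv]
    constructor
    · intro e
      exact ⟨s k, ⟨k, s, hs, rfl, hu⟩, ⟨l, t, ht, e.symm, hv⟩⟩
    · rintro ⟨b, h1, h2⟩
      exact (eq_of_mem_topClass h1 hs hu).symm.trans (eq_of_mem_topClass h2 ht hv)
  refine ⟨fun u => ?_, fun {u v} h => ?_, fun {u v w} h1 h2 => ?_⟩
  · obtain ⟨b, hb⟩ := mem_chainForms_I_iff_exists_mem_topClass.1 u.2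
    exact (key u u).2 ⟨b, hb, hb⟩
  · obtain ⟨b, hu, hv⟩ := (key u v).1 h
    exact (key v u).2 ⟨b, hv, hu⟩
  · obtain ⟨b, hu, hv⟩ := (key u v).1 h1
    obtain ⟨c, hv', hw⟩ := (key v w).1 h2
    exact (key u w).2 ⟨b, hu, topClass_unique hv' hv ▸ hw⟩

theorem topClass_nonempty (hirr : (coxeterGraph M).Connected) (hJ : J ≠ Set.univ) (b : B) :
    (topClass cs J b).Nonempty := by
  obtain ⟨k, s, hs, e⟩ := exists_isSimpleSeq hirr hJ b
  exact ⟨hs.rigid.toMinRep cs hs.2.1, k, s, hs, e, rfl⟩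

/-- The node of a generator. -/
def nodeOf (cs : CoxeterSystem M W) (hirr : (coxeterGraph M).Connected) (hJ : J ≠ Set.univ)
    (b : B) : Node (chainForms cs J) :=
  ⟨topClass cs J b, (topClass_nonempty hirr hJ b).some,
    mem_chainForms_I_iff_exists_mem_topClass.2 ⟨b, (topClass_nonempty hirr hJ b).some_mem⟩,
    (simClass_eq (topClass_nonempty hirr hJ b).some_mem).symm⟩

theorem nodeOf_bijective (hirr : (coxeterGraph M).Connected) (hJ : J ≠ Set.univ) :
    Function.Bijective (nodeOf cs hirr hJ) := by
  constructor
  · intro b c h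
    have h' : topClass cs J b = topClass cs J c := congrArg Subtype.val h
    obtain ⟨w, hw⟩ := topClass_nonempty (cs := cs) hirr hJ b
    exact topClass_unique hw (h' ▸ hw)
  · rintro ⟨U, u, hu, rfl⟩
    obtain ⟨b, hb⟩ := mem_chainForms_I_iff_exists_mem_topClass.1 hu
    exact ⟨b, Subtype.ext (simClass_eq hb).symm⟩

theorem exists_height_eq_one_iff {b : B} :
    (∃ u ∈ topClass cs J b, Order.height u = 1) ↔ b ∉ J := by
  constructor
  · rintro ⟨u, ⟨k, s, hs, rfl, hu⟩, h⟩
    rw [MinRep.height_eq, hu, hs.rigid.length] at h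
    obtain rfl : k = 0 := by
      have : k + 1 = 1 := by exact_mod_cast h
      omega
    exact hs.2.1
  · intro hb
    have hs : IsSimpleSeq M J 0 (fun _ => b) := by
      refine ⟨fun i hi j hj _ => by omega, hb, fun i h1 h2 => by omega, fun i hi j hj => ?_⟩
      rw [m_self]
      exact iff_of_false (by decide) (by omega)
    refine ⟨hs.rigid.toMinRep cs hb, ⟨0, _, hs, rfl, rfl⟩, ?_⟩
    rw [MinRep.height_eq]
    exact_mod_cast congrArg Nat.cast (hs.rigid.length (cs := cs))

theorem three_le_of_isUniqueLowerCover {a b : B} {u v : MinRep cs J}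
    (hu : u ∈ topClass cs J a) (hv : v ∈ topClass cs J b) (h : IsUniqueLowerCover u v) :
    3 ≤ m M a b := by
  obtain ⟨k, s, hs, rfl, hu⟩ := hu
  obtain ⟨l, t, ht, rfl, hv⟩ := hv
  have e := ht.eq_of_isUniqueLowerCover hv h
  obtain ⟨rfl, e2⟩ := hs.rigid.eq_of_pathProd_eq (ht.rigid.mono (Nat.le_succ l))
    (hu.symm.trans e)
  rw [e2 k (by omega)]
  exact (ht.2.2.2 k (by omega) (k + 1) le_rfl).2 (Or.inl rfl)

/-- By uniqueness of rigid words, a common lower cover means that the two paths agree up to their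
end vertices and form a fork. -/
theorem Mfun_eq_of_isUniqueLowerCover {a b : B} (hab : a ≠ b) {u v x : MinRep cs J}
    (hu : u ∈ topClass cs J a) (hv : v ∈ topClass cs J b) (hxu : IsUniqueLowerCover x u)
    (hxv : IsUniqueLowerCover x v) : Mfun u v = m M a b := by
  obtain ⟨k, s, hs, rfl, hu⟩ := hu
  obtain ⟨l, t, ht, rfl, hv⟩ := hv
  have e1 := hs.eq_of_isUniqueLowerCover hu hxu
  have e2 := ht.eq_of_isUniqueLowerCover hv hxv
  obtain ⟨rfl, e⟩ := (hs.rigid.mono (Nat.le_succ k)).eq_of_pathProd_eq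
    (ht.rigid.mono (Nat.le_succ l)) (e1.symm.trans e2)
  exact Fork.Mfun_eq ⟨hs, ht, e, hab⟩ hu hv

theorem Fork.exists_mem_topClass {k : ℕ} {s t : ℕ → B} (h : Fork M J k s t) :
    ∃ u ∈ topClass cs J (s k), ∃ v ∈ topClass cs J (t k),
      (∃ x, IsUniqueLowerCover x u ∧ IsUniqueLowerCover x v) ∧ Mfun u v = m M (s k) (t k) := by
  obtain ⟨x, hx, hxu⟩ := h.left.exists_isUniqueLowerCover (cs := cs)
    (w := h.left.rigid.toMinRep cs h.left.2.1) rfl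
  obtain ⟨y, hy, hyv⟩ := h.right.exists_isUniqueLowerCover (cs := cs)
    (w := h.right.rigid.toMinRep cs h.right.2.1) rfl
  have hxy : x = y := MinRep.eq_iff.2 (hx.trans ((pathProd_congr h.eq).trans hy.symm))
  exact ⟨_, ⟨k, s, h.left, rfl, rfl⟩, _, ⟨k, t, h.right, rfl, rfl⟩, ⟨x, hxu, hxy ▸ hyv⟩,
    h.Mfun_eq rfl rfl⟩

theorem IsSimpleSeq.exists_mem_topClass {k : ℕ} {s : ℕ → B} (h : IsSimpleSeq M J (k + 1) s) :
    ∃ u ∈ topClass cs J (s k), ∃ v ∈ topClass cs J (s (k + 1)), IsUniqueLowerCover u v := by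
  obtain ⟨x, hx, hxu⟩ := h.exists_isUniqueLowerCover (cs := cs)
    (w := h.rigid.toMinRep cs h.2.1) rfl
  exact ⟨x, ⟨k, s, h.mono (Nat.le_succ k), rfl, hx⟩, _, ⟨k + 1, s, h, rfl, rfl⟩, hxu⟩

theorem joined_iff (hirr : (coxeterGraph M).Connected) (hJ : J ≠ Set.univ) {a b : B}
    (hab : a ≠ b) : Joined (topClass cs J a) (topClass cs J b) ↔ 3 ≤ m M a b := by
  constructor
  · rintro ⟨u, hu, v, hv, (h | h) | ⟨⟨x, hxu, hxv⟩, h⟩⟩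
    · exact three_le_of_isUniqueLowerCover hu hv h
    · rw [m_comm]
      exact three_le_of_isUniqueLowerCover hv hu h
    · rwa [Mfun_eq_of_isUniqueLowerCover hab hu hv hxu hxv] at h
  · intro h
    rcases exists_of_adj hirr hJ h with ⟨k, f, hf, rfl, rfl⟩ | ⟨k, f, hf, rfl, rfl⟩ |
      ⟨k, f, g, hfg, rfl, rfl⟩
    · obtain ⟨u, hu, v, hv, huv⟩ := hf.exists_mem_topClass (cs := cs)
      exact ⟨u, hu, v, hv, Or.inl (Or.inl huv)⟩
    · obtain ⟨u, hu, v, hv, huv⟩ := hf.exists_mem_topClass (cs := cs)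
      exact ⟨v, hv, u, hu, Or.inl (Or.inr huv)⟩
    · obtain ⟨u, hu, v, hv, hx, e⟩ := hfg.exists_mem_topClass (cs := cs)
      exact ⟨u, hu, v, hv, Or.inr ⟨hx, by rwa [e]⟩⟩

theorem IsSimpleSeq.exists_form_II {k : ℕ} {s : ℕ → B} (h : IsSimpleSeq M J (k + 1) s)
    (h4 : 4 ≤ m M (s (k + 1)) (s k)) : ∃ u ∈ chainForms cs J .II, ∃ u' ∈ chainForms cs J .I,
      ∃ u'', IsUniqueLowerCover u' u ∧ IsUniqueLowerCover u'' u' ∧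
        u' ∈ topClass cs J (s (k + 1)) ∧ u'' ∈ topClass cs J (s k) ∧
        m M (s (k + 1)) (s k) = {w | w ∈ chainForms cs J .III ∧ u < w}.encard + 4 := by
  have h0 : extSeq s k (s (k + 1)) 0 ∉ J := by
    rw [extSeq_of_le (Nat.zero_le k)]
    exact h.2.1
  have hr : Rigid M (extSeq s k (s (k + 1))) (k + 3) :=
    h.rigid_extSeq (p := 3) (lt_of_lt_of_le (by norm_num) h4)
  obtain ⟨x, hx, hxu⟩ := h.exists_isUniqueLowerCover (cs := cs)
    (w := h.rigid.toMinRep cs h.2.1) rfl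
  exact ⟨hr.toMinRep cs h0, mem_chainForms_II h h4 rfl, h.rigid.toMinRep cs h.2.1,
    mem_chainForms_I.2 ⟨k + 1, s, h, rfl⟩, x,
    isUniqueLowerCover_of_chainCond (n := k + 2) hr (chainCond_extSeq h)
      (pathProd_congr fun i hi => (extSeq_of_le' (by omega)).symm) rfl, hxu,
    ⟨k + 1, s, h, rfl, rfl⟩, ⟨k, s, h.mono (Nat.le_succ k), rfl, hx⟩,
    (encard_form_III h h4 rfl).symm⟩

theorem eq_of_labelThree {a b : B} {n : ℕ∞}
    (h : LabelThree (chainForms cs J) (topClass cs J a) (topClass cs J b) n) :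
    n = m M a b ∧ 4 ≤ m M a b := by
  obtain ⟨u, hu, u', hu', u'', h1, h2, h3, rfl⟩ := h
  obtain ⟨k, s, hs, h4, e1, e2⟩ := exists_of_mem_chainForms_II hu hu' h1
  rw [encard_form_III hs h4 e1]
  have e3 := hs.eq_of_isUniqueLowerCover e2 h2
  rcases h3 with ⟨ha, hb⟩ | ⟨hb, ha⟩
  · rw [eq_of_mem_topClass ha hs e2, eq_of_mem_topClass hb (hs.mono (Nat.le_succ k)) e3]
    exact ⟨rfl, h4⟩
  · rw [eq_of_mem_topClass hb hs e2, eq_of_mem_topClass ha (hs.mono (Nat.le_succ k)) e3,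
      m_comm M (s k)]
    exact ⟨rfl, h4⟩

/-- Every label written by either step equals `m(a, b)`, so labels never conflict. Conversely, an
edge with `m(a, b) ≥ 4` is labelled by step 3 if it is the last step of a path and by step 2 if it
comes from a fork. -/
theorem label_iff (hirr : (coxeterGraph M).Connected) (hJ : J ≠ Set.univ) {a b : B} (n : ℕ∞) :
    (a ≠ b ∧ LabelTwo (topClass cs J a) (topClass cs J b) n) ∨
      LabelThree (chainForms cs J) (topClass cs J a) (topClass cs J b) n ↔
    n = m M a b ∧ 4 ≤ m M a b := by
  constructor
  · rintro (⟨hab, u, hu, v, hv, ⟨x, hxu, hxv⟩, h4, rfl⟩ | h)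
    · rw [Mfun_eq_of_isUniqueLowerCover hab hu hv hxu hxv] at h4 ⊢
      exact ⟨rfl, h4⟩
    · exact eq_of_labelThree h
  · rintro ⟨rfl, h4⟩
    have h3 : 3 ≤ m M a b := le_trans (by norm_num) h4
    rcases exists_of_adj hirr hJ h3 with ⟨k, f, hf, rfl, rfl⟩ | ⟨k, f, hf, rfl, rfl⟩ |
      ⟨k, f, g, hfg, rfl, rfl⟩
    · rw [m_comm] at h4 ⊢
      obtain ⟨u, hu, u', hu', u'', e1, e2, e3, e4, e⟩ := hf.exists_form_II (cs := cs) h4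
      exact Or.inr ⟨u, hu, u', hu', u'', e1, e2, Or.inr ⟨e3, e4⟩, e⟩
    · obtain ⟨u, hu, u', hu', u'', e1, e2, e3, e4, e⟩ := hf.exists_form_II (cs := cs) h4
      exact Or.inr ⟨u, hu, u', hu', u'', e1, e2, Or.inl ⟨e3, e4⟩, e⟩
    · obtain ⟨u, hu, v, hv, hx, e⟩ := hfg.exists_mem_topClass (cs := cs)
      exact Or.inl ⟨hfg.ne, u, hu, v, hv, hx, by rwa [e], e.symm⟩

theorem construction_isIsomorphic (hirr : (coxeterGraph M).Connected) (hJ : J ≠ Set.univ) :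
    (construction (chainForms cs J)).IsIsomorphic (bwCoxeterGraph M J) := by
  have hbij := nodeOf_bijective (cs := cs) hirr hJ
  have hne : ∀ a b, nodeOf cs hirr hJ a ≠ nodeOf cs hirr hJ b ↔ a ≠ b :=
    fun a b => hbij.1.ne_iff
  refine ⟨(Equiv.ofBijective _ hbij).symm, fun x => ?_, fun x y => ?_, fun x y => ?_⟩
  · obtain ⟨b, rfl⟩ := hbij.2 x
    rw [Equiv.ofBijective_symm_apply_apply]
    exact exists_height_eq_one_iff
  · obtain ⟨a, rfl⟩ := hbij.2 x
    obtain ⟨b, rfl⟩ := hbij.2 y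
    rw [Equiv.ofBijective_symm_apply_apply, Equiv.ofBijective_symm_apply_apply]
    change _ ≠ _ ∧ _ ↔ 3 ≤ m M a b
    rw [hne]
    constructor
    · rintro ⟨hab, h⟩
      exact (joined_iff hirr hJ hab).1 h
    · intro h
      have hab : a ≠ b := by
        rintro rfl
        rw [m_self] at h
        exact absurd h (by decide)
      exact ⟨hab, (joined_iff hirr hJ hab).2 h⟩
  · obtain ⟨a, rfl⟩ := hbij.2 x
    obtain ⟨b, rfl⟩ := hbij.2 y
    rw [Equiv.ofBijective_symm_apply_apply, Equiv.ofBijective_symm_apply_apply]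
    ext n
    change (_ ≠ _ ∧ _) ∨ _ ↔ _
    rw [hne]
    exact label_iff hirr hJ n

end Main

end BWCoxeter

end

theorem mainTheorem6 {B W : Type*} [Finite B] [Group W] {M : CoxeterMatrix B}
    (cs : CoxeterSystem M W) (J : Set B)
    (hirr : (BWCoxeter.coxeterGraph M).Connected) (hJ : J ≠ Set.univ) :
    Equivalence (BWCoxeter.SimI (BWCoxeter.chainForms cs J)) ∧
    (BWCoxeter.construction (BWCoxeter.chainForms cs J)).IsIsomorphic
      (BWCoxeter.bwCoxeterGraph M J) :=
  ⟨BWCoxeter.equivalence_simI, BWCoxeter.construction_isIsomorphic hirr hJ⟩
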